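/- **Notation.** For an $n\times n$ complex matrix $A_n$ let $a_{k;j}=a_{k;j}(n)$ ($-n<k<n$, $0\le j<n-|k|$) be the $j$-th entry of its $k$-th diagonal: with rows and columns numbered from $0$, it is the entry in row $j$ and column $j+k$ if $k\ge 0$, and in row $j+|k|$ and column $j$ if $k<0$; put $a_{k;j}(n)=0$ for all other $k\in\mathbb Z$, $j\ge 0$. Let $l^1$ be the Banach space of summable sequences $\boldsymbol z=(z_k)_{k\in\mathbb Z}$ of complex numbers, and put $F(\boldsymbol z,t)=\sum_{k\in\mathbb Z}z_k e^{ikt}$ for $\boldsymbol z\in l^1$, $t\in\mathbb R$. For $0\le j\le n$ let $\boldsymbol a_j(n)=(\dots,0,a_{-j;j},a_{-j+1;j},\dots,a_{n-j;j},0,\dots)\in l^1$, with $a_{k;j}$ at position $k$. **Theorem.** Let $\{A_n\}$ be a sequence of $n\times n$ complex matrices, let $X\subset l^1$ be compact and let $\mu$ be a Borel probability measure on $X$. Assume: 1. $\{A_n\}$ is of vanishing mean variation: for each $k\in\mathbb Z$, $\sum_{0\le j<n-|k|-1}|a_{k;j+1}(n)-a_{k;j}(n)|=o(n)$ as $n\to\infty$;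 2. $\{A_n\}$ is $\mu$-distributed: $\frac1n\sum_{j=0}^{n}\delta_{\boldsymbol a_j(n)}$ converges weakly to $\mu$ as measures on $l^1$, i.e. $\frac1n\sum_{j=0}^n f(\boldsymbol a_j(n))\to\int_X f\,d\mu$ for every bounded continuous $f:l^1\to\mathbb R$; 3. $\displaystyle M:=\sup_n\sum_{|k|\le n}\max_{j}|a_{k;j}(n)|<\infty .$ Let $D_M=\{z\in\mathbb C:|z|\le M\}$, and let $\lambda_1(A_n),\dots,\lambda_n(A_n)$ be the eigenvalues of $A_n$, repeated according to algebraic multiplicity. Then all $\lambda_k(A_n)$ lie in $D_M$; for $\mu$-almost every $\boldsymbol z$ one has $F(\boldsymbol z,t)\in D_M$ for all $t$; and for every complex-valued $\varphi$ that is continuous on $D_M$ and analytic in the interior of $D_M$ (in particular, for every $\varphi$ analytic on a neighbourhood of $D_M$), the function $(\boldsymbol z,t)\mapsto\varphi(F(\boldsymbol z,t))$ is integrable on $X\times(-\pi,\pi]$ with respect to $\mu\otimes dt$ and $$\lim_{n\to\infty}\frac1n\sum_{k=1}^n\varphi(\lambda_k(A_n))=\frac1{2\pi}\int_{-\pi}^{\pi}\int_X\varphi(F(\boldsymbol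 z,t))\,d\mu(\boldsymbol z)\,dt .$$ If moreover all $A_n$ are Hermitian, then for $\mu$-almost every $\boldsymbol z$ the number $F(\boldsymbol z,t)$ is real for all $t$, and the same integrability and the same limit formula hold for every continuous $\varphi:[-M,M]\to\mathbb C$. -/

import Mathlib

open Filter Topology MeasureTheory
open scoped BoundedContinuousFunction NNReal

/-- The space `ℓ¹(ℤ, ℂ)` of summable two-sided complex sequences, with its norm. -/
abbrev EllOne : Type := lp (fun _ : ℤ => ℂ) 1

/-- A sequence of square matrices, the `n`-th one of size `n × n`. -/
abbrev MatrixSeq : Type := ∀ n : ℕ, Matrix (Fin n) (Fin n) ℂ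

/-- The entry `a_{k;j}` of an `n × n` matrix: the `j`-th entry (`j = 0, 1, …`) of the `k`-th
diagonal. For `k ≥ 0` it stands in row `j` and column `j + k`, for `k < 0` in row `j + |k|` and
column `j` (rows and columns numbered from `0`). It is `0` if this position is outside the
matrix. -/
def diagEntry {n : ℕ} (A : Matrix (Fin n) (Fin n) ℂ) (k : ℤ) (j : ℕ) : ℂ :=
  if h : j + (-k).toNat < n ∧ j + k.toNat < n then
    A ⟨j + (-k).toNat, h.1⟩ ⟨j + k.toNat, h.2⟩
  else 0

/-- Vanishing mean variation: along each diagonal, the sum of the absolute differences of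
consecutive entries is `o(n)`. The `k`-th diagonal of an `n × n` matrix has `n - |k|` entries. -/
def VanishingMeanVariation (A : MatrixSeq) : Prop :=
  ∀ k : ℤ,
    (fun n : ℕ => ∑ j ∈ Finset.range (n - k.natAbs - 1),
      ‖diagEntry (A n) k (j + 1) - diagEntry (A n) k j‖) =o[atTop] fun n : ℕ => (n : ℝ)

/-- The largest modulus of an entry on the `k`-th diagonal (`0` if that diagonal is empty). -/
noncomputable def diagMax {n : ℕ} (A : Matrix (Fin n) (Fin n) ℂ) (k : ℤ) : ℝ≥0 :=
  (Finset.range n).sup fun j => ‖diagEntry A k j‖₊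

/-- The sum over all diagonals of the largest modulus of an entry. -/
noncomputable def diagMaxSum {n : ℕ} (A : Matrix (Fin n) (Fin n) ℂ) : ℝ :=
  ∑ k ∈ Finset.Icc (-(n : ℤ)) n, (diagMax A k : ℝ)

/-- The finitely supported sequence `(…, 0, a_{-j;j}, a_{-j+1;j}, …, a_{n-j;j}, 0, …)`,
the entry `a_{k;j}` being at position `k`. -/
noncomputable def diagSeq {n : ℕ} (A : Matrix (Fin n) (Fin n) ℂ) (j : ℕ) : EllOne :=
  ⟨fun k : ℤ => if -(j : ℤ) ≤ k ∧ k ≤ (n : ℤ) - j then diagEntry A k j else 0, by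
    refine Memℓp.of_exponent_ge (memℓp_zero ?_) (zero_le (a := (1 : ENNReal)))
    refine (Set.finite_Icc (-(j : ℤ)) ((n : ℤ) - j)).subset ?_
    intro k hk
    by_contra hcon
    exact hk (if_neg hcon)⟩

/-- The sequence `A` is `μ`-distributed, for a Borel measure `μ` on `X ⊆ ℓ¹`: the measures
`(1/n) ∑_{j=0}^{n} δ_{a_j(n)}` on `ℓ¹` converge weakly to `μ` (seen as a measure on `ℓ¹`). -/
def IsMuDistributed [MeasurableSpace EllOne] (A : MatrixSeq) (X : Set EllOne)
    (μ : Measure X) : Prop :=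
  ∀ f : EllOne →ᵇ ℝ,
    Tendsto (fun n : ℕ => (n : ℝ)⁻¹ * ∑ j ∈ Finset.range (n + 1), f (diagSeq (A n) j))
      atTop (𝓝 (∫ z : X, f (z : EllOne) ∂μ))

/-- The Fourier series `F(z, t) = ∑_{k ∈ ℤ} z_k e^{ikt}`. -/
noncomputable def fourierF (z : EllOne) (t : ℝ) : ℂ :=
  ∑' k : ℤ, z k * Complex.exp (Complex.I * (k : ℂ) * (t : ℂ))

/-! Everything reduces to moments. The sum of the `m`-th powers of the eigenvalues is the trace of
`A n ^ m`, and `φ` is a uniform limit of polynomials on a set containing all eigenvalues and almost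
all values of `F`: the disc in general, its real diameter in the Hermitian case. So it suffices that
the mean trace of `A n ^ m` tends to the mean of `F ^ m` over `μ` and the circle
(`tendsto_trace_pow`).

If only finitely many diagonals are present, a diagonal entry of the `m`-th power is a sum of
products of entries from nearby rows. Vanishing mean variation allows all of them to be moved to one
row at total cost `o(n)` (`negligible_powFun_sub_convFun`). What remains is the coefficient at `0`
of the `m`-th convolution power of `a_j(n)`, that is, the mean of the `m`-th power of its Fourier
sum. It is continuous in the sequence and bounded on the ball of radius `M`, so its averages over
`j` converge by weak convergence.

General matrices are cut down to a band. Row and column sums bounded by `M` turn the entrywise error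
into an error of traces of powers (`Matrix.entrySum_pow_sub_pow_le`). For the diagonals above `K`
this error is the mean upper tail of the `a_j(n)`, which converges to its `μ`-integral and so is
small for large `K`. The lower tail cannot be treated in this way, because `a_j(n)` omits the
positions below `-j`. It need not be: a closed walk of `m` steps, each raising the index by at most
`K`, has no step lowering it by more than `m * K`, so the far lower diagonals do not affect the
trace once the far upper ones are gone (`trace_keepDiagonals_pow_eq`). -/

open scoped ENNReal

/-! ### Calculus of functions on `ℤ` modulo errors of `ℓ¹` size `o(n)`. -/

/-- A sequence of functions on `ℤ` is negligible if the sums of its moduli are `o(n)`. -/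
def Negligible (u : ℕ → ℤ → ℂ) : Prop :=
  Tendsto (fun n : ℕ => (∑' i : ℤ, ‖u n i‖ₑ) / (n : ℝ≥0∞)) atTop (𝓝 0)

/-- A sequence of functions on `ℤ` is uniformly bounded. -/
def UniformlyBounded (u : ℕ → ℤ → ℂ) : Prop := ∃ C : ℝ≥0, ∀ n i, ‖u n i‖ₑ ≤ C

/-- A sequence of functions on `ℤ` is slowly varying if its increments are negligible. -/
def SlowlyVarying (u : ℕ → ℤ → ℂ) : Prop := Negligible fun n i => u n (i + 1) - u n i

namespace Negligible

variable {u v : ℕ → ℤ → ℂ}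

theorem of_enorm_le {C : ℝ≥0} (hv : Negligible v) (h : ∀ n i, ‖u n i‖ₑ ≤ C * ‖v n i‖ₑ) :
    Negligible u := by
  have h1 : Tendsto (fun n : ℕ => (C : ℝ≥0∞) * ((∑' i : ℤ, ‖v n i‖ₑ) / (n : ℝ≥0∞))) atTop
      (𝓝 (C * 0)) := ENNReal.Tendsto.const_mul hv (Or.inr ENNReal.coe_ne_top)
  rw [mul_zero] at h1
  refine tendsto_of_tendsto_of_tendsto_of_le_of_le tendsto_const_nhds h1 (fun _ => zero_le) ?_
  intro n
  simp only
  rw [← mul_div_assoc, ← ENNReal.tsum_mul_left]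
  gcongr with i
  exact h n i

theorem zero : Negligible fun _ _ => 0 := by
  simp only [Negligible, enorm_zero, tsum_zero, ENNReal.zero_div]
  exact tendsto_const_nhds

theorem add (hu : Negligible u) (hv : Negligible v) : Negligible fun n i => u n i + v n i := by
  have h1 := Tendsto.add hu hv
  rw [add_zero] at h1
  refine tendsto_of_tendsto_of_tendsto_of_le_of_le tendsto_const_nhds h1 (fun _ => zero_le) ?_
  intro n
  simp only
  rw [← ENNReal.add_div, ← ENNReal.tsum_add]
  gcongr with i
  exact enorm_add_le _ _

theorem neg (hu : Negligible u) : Negligible fun n i => - u n i := by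
  simpa only [Negligible, enorm_neg] using hu

theorem sub (hu : Negligible u) (hv : Negligible v) : Negligible fun n i => u n i - v n i := by
  simpa only [sub_eq_add_neg] using hu.add hv.neg

theorem sum {ι : Type*} (S : Finset ι) {w : ι → ℕ → ℤ → ℂ} (h : ∀ k ∈ S, Negligible (w k)) :
    Negligible fun n i => ∑ k ∈ S, w k n i := by
  classical
  induction S using Finset.induction_on with
  | empty => simpa using zero
  | insert a S ha ih =>
    simp only [Finset.sum_insert ha]
    exact (h a (Finset.mem_insert_self a S)).add
      (ih fun k hk => h k (Finset.mem_insert_of_mem hk))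

theorem shift (hu : Negligible u) (k : ℤ) : Negligible fun n i => u n (i + k) := by
  have h : ∀ n, ∑' i : ℤ, ‖u n (i + k)‖ₑ = ∑' i : ℤ, ‖u n i‖ₑ := fun n =>
    (Equiv.addRight k).tsum_eq fun i => ‖u n i‖ₑ
  simpa only [Negligible, h] using hu

theorem bounded_mul (hu : UniformlyBounded u) (hv : Negligible v) :
    Negligible fun n i => u n i * v n i := by
  obtain ⟨C, hC⟩ := hu
  refine hv.of_enorm_le (C := C) fun n i => ?_
  rw [enorm_mul]
  gcongr
  exact hC n i

theorem mul_bounded (hu : Negligible u) (hv : UniformlyBounded v) :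
    Negligible fun n i => u n i * v n i := by
  simpa only [mul_comm] using hu.bounded_mul hv

theorem of_tsum_le_real {f : ℕ → ℝ} (hf : f =o[atTop] fun n : ℕ => (n : ℝ))
    (h : ∀ n, ∑' i : ℤ, ‖u n i‖ₑ ≤ ENNReal.ofReal (f n)) : Negligible u := by
  have h1 : Tendsto (fun n => ENNReal.ofReal (f n / n)) atTop (𝓝 0) := by
    simpa using ENNReal.tendsto_ofReal hf.tendsto_div_nhds_zero
  refine tendsto_of_tendsto_of_tendsto_of_le_of_le' tendsto_const_nhds h1
    (Eventually.of_forall fun _ => zero_le) ?_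
  filter_upwards [eventually_gt_atTop 0] with n hn
  rw [ENNReal.ofReal_div_of_pos (by exact_mod_cast hn), ENNReal.ofReal_natCast]
  gcongr
  exact h n

theorem of_tsum_le_const {C : ℝ≥0} (h : ∀ n, ∑' i : ℤ, ‖u n i‖ₑ ≤ C) : Negligible u := by
  refine of_tsum_le_real (f := fun _ => (C : ℝ)) ?_ fun n => by simpa using h n
  exact Asymptotics.isLittleO_const_left.2 (Or.inr (by
    simpa [Function.comp_def] using tendsto_natCast_atTop_atTop (R := ℝ)))

/-- A bounded sequence supported in a fixed finite set is negligible. -/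
theorem of_support (hu : UniformlyBounded u) (s : Finset ℤ) (h : ∀ n, ∀ i ∉ s, u n i = 0) :
    Negligible u := by
  obtain ⟨C, hC⟩ := hu
  refine of_tsum_le_const (C := s.card * C) fun n => ?_
  rw [tsum_eq_sum (s := s) fun i hi => by rw [h n i hi, enorm_zero]]
  refine (Finset.sum_le_sum fun i _ => hC n i).trans ?_
  simp

theorem tendsto_sum (hu : Negligible u) (s : ℕ → Finset ℤ) :
    Tendsto (fun n : ℕ => (n : ℂ)⁻¹ * ∑ i ∈ s n, u n i) atTop (𝓝 0) := by
  rw [tendsto_zero_iff_norm_tendsto_zero]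
  have h1 := (ENNReal.tendsto_toReal ENNReal.zero_ne_top).comp hu
  -- The quotient may be `∞` for small `n`; `toReal` is monotone only where it is finite.
  have hfin : ∀ᶠ n : ℕ in atTop, (∑' i : ℤ, ‖u n i‖ₑ) / (n : ℝ≥0∞) < 1 :=
    Tendsto.eventually_lt_const one_pos hu
  refine tendsto_of_tendsto_of_tendsto_of_le_of_le' tendsto_const_nhds h1
    (Eventually.of_forall fun _ => norm_nonneg _) ?_
  filter_upwards [hfin] with n hn
  simp only [Function.comp_apply]
  rw [← toReal_enorm]
  refine ENNReal.toReal_mono hn.ne_top ?_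
  rw [enorm_mul, mul_comm, ENNReal.div_eq_inv_mul, mul_comm]
  rcases Nat.eq_zero_or_pos n with rfl | hn0
  · simp
  · rw [enorm_inv (by exact_mod_cast hn0.ne')]
    have : ‖(n : ℂ)‖ₑ = (n : ℝ≥0∞) := by
      rw [← ofReal_norm, Complex.norm_natCast, ENNReal.ofReal_natCast]
    rw [this]
    gcongr
    exact (enorm_sum_le _ _).trans (ENNReal.sum_le_tsum _)

end Negligible

namespace UniformlyBounded

variable {u v : ℕ → ℤ → ℂ}

theorem shift (hu : UniformlyBounded u) (k : ℤ) : UniformlyBounded fun n i => u n (i + k) := by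
  obtain ⟨C, hC⟩ := hu
  exact ⟨C, fun n i => hC n _⟩

theorem mul (hu : UniformlyBounded u) (hv : UniformlyBounded v) :
    UniformlyBounded fun n i => u n i * v n i := by
  obtain ⟨C, hC⟩ := hu
  obtain ⟨D, hD⟩ := hv
  refine ⟨C * D, fun n i => ?_⟩
  rw [enorm_mul, ENNReal.coe_mul]
  exact mul_le_mul' (hC n i) (hD n i)

theorem add (hu : UniformlyBounded u) (hv : UniformlyBounded v) :
    UniformlyBounded fun n i => u n i + v n i := by
  obtain ⟨C, hC⟩ := hu
  obtain ⟨D, hD⟩ := hv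
  refine ⟨C + D, fun n i => (enorm_add_le _ _).trans ?_⟩
  rw [ENNReal.coe_add]
  exact add_le_add (hC n i) (hD n i)

theorem neg (hu : UniformlyBounded u) : UniformlyBounded fun n i => - u n i := by
  simpa only [UniformlyBounded, enorm_neg] using hu

theorem sub (hu : UniformlyBounded u) (hv : UniformlyBounded v) :
    UniformlyBounded fun n i => u n i - v n i := by
  simpa only [sub_eq_add_neg] using hu.add hv.neg

theorem sum {ι : Type*} (S : Finset ι) {w : ι → ℕ → ℤ → ℂ}
    (h : ∀ k ∈ S, UniformlyBounded (w k)) : UniformlyBounded fun n i => ∑ k ∈ S, w k n i := by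
  classical
  induction S using Finset.induction_on with
  | empty => exact ⟨0, by simp⟩
  | insert a S ha ih =>
    simp only [Finset.sum_insert ha]
    exact (h a (Finset.mem_insert_self a S)).add
      (ih fun k hk => h k (Finset.mem_insert_of_mem hk))

end UniformlyBounded

namespace SlowlyVarying

variable {u v : ℕ → ℤ → ℂ}

theorem shift (hu : SlowlyVarying u) (k : ℤ) : SlowlyVarying fun n i => u n (i + k) := by
  have := Negligible.shift hu k
  simpa only [SlowlyVarying, add_right_comm] using this

/-- Telescoping: `k` is fixed while `n` grows, so only boundedly many translates of the increment
are added. -/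
theorem shift_sub_nat (hu : SlowlyVarying u) (k : ℕ) :
    Negligible fun n i => u n (i + k) - u n i := by
  induction k with
  | zero => simpa using Negligible.zero
  | succ k ih =>
    have h := (Negligible.shift hu k).add ih
    convert h using 3
    push_cast
    rw [show ∀ i : ℤ, i + (k + 1) = i + k + 1 by intro i; ring]
    ring

theorem shift_sub (hu : SlowlyVarying u) (k : ℤ) :
    Negligible fun n i => u n (i + k) - u n i := by
  obtain ⟨m, rfl | rfl⟩ := k.eq_nat_or_neg
  · exact hu.shift_sub_nat m
  · have h := ((hu.shift_sub_nat m).shift (-m)).neg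
    simpa using h

theorem mul (hu : SlowlyVarying u) (hv : SlowlyVarying v) (hbu : UniformlyBounded u)
    (hbv : UniformlyBounded v) : SlowlyVarying fun n i => u n i * v n i := by
  have h := (Negligible.bounded_mul (hbu.shift 1) hv).add (Negligible.mul_bounded hu hbv)
  unfold SlowlyVarying
  convert h using 3
  ring

theorem sum {ι : Type*} (S : Finset ι) {w : ι → ℕ → ℤ → ℂ}
    (h : ∀ k ∈ S, SlowlyVarying (w k)) : SlowlyVarying fun n i => ∑ k ∈ S, w k n i := by
  unfold SlowlyVarying
  simp only [← Finset.sum_sub_distrib]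
  exact Negligible.sum S h

end SlowlyVarying

/-! ### Matrix entries extended by zero to `ℤ × ℤ`, and restriction to a set of diagonals. -/

/-- The entry of a matrix at integer coordinates, `0` outside of the matrix. -/
def extEntry {n : ℕ} (B : Matrix (Fin n) (Fin n) ℂ) (i j : ℤ) : ℂ :=
  if h : (0 ≤ i ∧ i < n) ∧ (0 ≤ j ∧ j < n) then
    B ⟨i.toNat, by omega⟩ ⟨j.toNat, by omega⟩ else 0

/-- The matrix obtained by keeping only the diagonals with index in `S`. -/
def keepDiagonals {n : ℕ} (S : Set ℤ) [DecidablePred (· ∈ S)] (B : Matrix (Fin n) (Fin n) ℂ) :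
    Matrix (Fin n) (Fin n) ℂ :=
  Matrix.of fun i j => if ((j : ℤ) - (i : ℤ)) ∈ S then B i j else 0

/-- The coefficient at `s` of the `m`-th convolution power of the restriction of `z` to `S`. -/
def convCoeff (S : Finset ℤ) : ℕ → ℤ → (ℤ → ℂ) → ℂ
  | 0, s, _ => if s = 0 then 1 else 0
  | m + 1, s, z => ∑ k ∈ S, z k * convCoeff S m (s - k) z

section extEntry

variable {n : ℕ} (B : Matrix (Fin n) (Fin n) ℂ)

@[simp]
theorem extEntry_coe (a b : Fin n) : extEntry B a b = B a b := by
  have : ((0 : ℤ) ≤ (a : ℕ) ∧ ((a : ℕ) : ℤ) < n) ∧ ((0 : ℤ) ≤ (b : ℕ) ∧ ((b : ℕ) : ℤ) < n) := by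
    omega
  simp [extEntry]

theorem extEntry_of_row {i : ℤ} (j : ℤ) (h : ¬ (0 ≤ i ∧ i < n)) : extEntry B i j = 0 :=
  dif_neg fun h' => h h'.1

theorem extEntry_of_col (i : ℤ) {j : ℤ} (h : ¬ (0 ≤ j ∧ j < n)) : extEntry B i j = 0 :=
  dif_neg fun h' => h h'.2

theorem enorm_extEntry_le {C : ℝ≥0∞} (h : ∀ a b, ‖B a b‖ₑ ≤ C) (i j : ℤ) :
    ‖extEntry B i j‖ₑ ≤ C := by
  unfold extEntry
  split_ifs
  · exact h _ _
  · simp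

/-- Extension by zero absorbs all boundary conditions, so the range of summation depends neither on
`n` nor on the row. -/
theorem extEntry_keepDiagonals_mul (S : Finset ℤ) (W : Matrix (Fin n) (Fin n) ℂ) (i j : ℤ) :
    extEntry (keepDiagonals (S : Set ℤ) B * W) i j =
      ∑ k ∈ S, extEntry B i (i + k) * extEntry W (i + k) j := by
  by_cases hi : 0 ≤ i ∧ i < n
  swap
  · simp [extEntry_of_row _ _ hi]
  by_cases hj : 0 ≤ j ∧ j < n
  swap
  · simp [extEntry_of_col _ _ hj]
  obtain ⟨a, rfl⟩ : ∃ a : Fin n, (a : ℤ) = i := ⟨⟨i.toNat, by omega⟩, by simp [hi.1]⟩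
  obtain ⟨b, rfl⟩ : ∃ b : Fin n, (b : ℤ) = j := ⟨⟨j.toNat, by omega⟩, by simp [hj.1]⟩
  rw [extEntry_coe, Matrix.mul_apply]
  have h1 : ∀ l : Fin n, keepDiagonals (S : Set ℤ) B a l * W l b =
      ∑ k ∈ S, if k = (l : ℤ) - a then B a l * W l b else 0 := by
    intro l
    simp [keepDiagonals, Finset.sum_ite_eq', ite_mul]
  simp_rw [h1]
  rw [Finset.sum_comm]
  refine Finset.sum_congr rfl fun k _ => ?_
  by_cases hk : 0 ≤ (a : ℤ) + k ∧ (a : ℤ) + k < n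
  · obtain ⟨l, hl⟩ : ∃ l : Fin n, (l : ℤ) = a + k :=
      ⟨⟨((a : ℤ) + k).toNat, by omega⟩, by simp [hk.1]⟩
    rw [← hl, extEntry_coe, extEntry_coe, Finset.sum_eq_single l]
    · rw [if_pos (by omega)]
    · intro l' _ hne
      rw [if_neg]
      intro h
      exact hne (Fin.ext (by omega))
    · simp
  · rw [extEntry_of_col _ _ hk, zero_mul]
    refine Finset.sum_eq_zero fun l _ => if_neg ?_
    omega

theorem diagEntry_eq_extEntry (k : ℤ) (j : ℕ) :
    diagEntry B k j = extEntry B (j + (-k).toNat) (j + k.toNat) := by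
  unfold diagEntry extEntry
  split_ifs with h1 h2 h2
  · congr 1
  · omega
  · omega
  · rfl

theorem sum_extEntry_diag (s : ℕ → ℂ) :
    ∑ i ∈ (Finset.range n).map Nat.castEmbedding, (extEntry B i i - s i.toNat) =
      B.trace - ∑ j ∈ Finset.range n, s j := by
  rw [Finset.sum_map, Matrix.trace, Finset.sum_range, Finset.sum_range, ← Finset.sum_sub_distrib]
  simp

end extEntry

/-! ### Diagonals of powers of banded matrices. -/

section BandedSeq

variable (A : MatrixSeq)

/-- The `k`-th diagonals as functions on `ℤ`, indexed by the smaller coordinate. -/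
def diagFun (k : ℤ) (n : ℕ) (j : ℤ) : ℂ := if 0 ≤ j then diagEntry (A n) k j.toNat else 0

/-- The `k`-th diagonals as functions on `ℤ`, indexed by the row. -/
def rowFun (k : ℤ) (n : ℕ) (i : ℤ) : ℂ := extEntry (A n) i (i + k)

/-- The entries at `k` of the sequences `diagSeq`, as functions on `ℤ`. -/
noncomputable def seqFun (k : ℤ) (n : ℕ) (j : ℤ) : ℂ :=
  if 0 ≤ j ∧ j < n then diagSeq (A n) j.toNat k else 0

variable {A}

/-- For `k < 0` the `j`-th entry lies in row `j + |k|`, so the two indexings differ by a translation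
depending only on `k`. -/
theorem rowFun_eq_diagFun_shift (k : ℤ) (n : ℕ) (i : ℤ) :
    rowFun A k n i = diagFun A k n (i + (-((-k).toNat : ℤ))) := by
  unfold rowFun diagFun
  split_ifs with h
  · rw [diagEntry_eq_extEntry]
    congr 1 <;> omega
  · by_cases hk : 0 ≤ k
    · exact extEntry_of_row _ _ (by omega)
    · exact extEntry_of_col _ _ (by omega)

theorem enorm_diagFun_le {C : ℝ≥0} (hC : ∀ n a b, ‖A n a b‖ₑ ≤ C) (k : ℤ) (n : ℕ) (j : ℤ) :
    ‖diagFun A k n j‖ₑ ≤ C := by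
  unfold diagFun
  split_ifs
  · rw [diagEntry_eq_extEntry]
    exact enorm_extEntry_le _ (hC n) _ _
  · simp

theorem diagSeq_apply {n : ℕ} (B : Matrix (Fin n) (Fin n) ℂ) (j : ℕ) (k : ℤ) :
    diagSeq B j k = if -(j : ℤ) ≤ k ∧ k ≤ (n : ℤ) - j then diagEntry B k j else 0 := rfl

theorem enorm_seqFun_le {C : ℝ≥0} (hC : ∀ n a b, ‖A n a b‖ₑ ≤ C) (k : ℤ) (n : ℕ) (j : ℤ) :
    ‖seqFun A k n j‖ₑ ≤ C := by
  unfold seqFun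
  split_ifs
  · rw [diagSeq_apply]
    split_ifs
    · rw [diagEntry_eq_extEntry]
      exact enorm_extEntry_le _ (hC n) _ _
    · simp
  · simp

theorem uniformlyBounded_rowFun {C : ℝ≥0} (hC : ∀ n a b, ‖A n a b‖ₑ ≤ C) (k : ℤ) :
    UniformlyBounded (rowFun A k) :=
  ⟨C, fun n _ => enorm_extEntry_le _ (hC n) _ _⟩

theorem slowlyVarying_diagFun {C : ℝ≥0} (hC : ∀ n a b, ‖A n a b‖ₑ ≤ C)
    (hA : VanishingMeanVariation A) (k : ℤ) : SlowlyVarying (diagFun A k) := by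
  -- The term `2 * C` pays for the two jumps caused by extension by zero, at `-1` and at `N - 1`,
  -- where `N` is the length of the diagonal.
  have hf : (fun n : ℕ => (2 * C : ℝ) + ∑ j ∈ Finset.range (n - k.natAbs - 1),
      ‖diagEntry (A n) k (j + 1) - diagEntry (A n) k j‖) =o[atTop] fun n : ℕ => (n : ℝ) := by
    refine Asymptotics.IsLittleO.add ?_ (hA k)
    exact Asymptotics.isLittleO_const_left.2 (Or.inr (by
      simpa [Function.comp_def] using tendsto_natCast_atTop_atTop (R := ℝ)))
  refine Negligible.of_tsum_le_real hf fun n => ?_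
  set N : ℕ := n - k.natAbs with hN
  have hz : ∀ j : ℤ, (N : ℤ) ≤ j → diagFun A k n j = 0 := by
    intro j hj
    unfold diagFun
    split_ifs
    · unfold diagEntry
      rw [dif_neg]
      omega
    · rfl
  have hz' : ∀ j : ℤ, j < 0 → diagFun A k n j = 0 := fun j hj => if_neg (by omega)
  have hs : ∀ i ∉ ({-1, (N : ℤ) - 1} : Finset ℤ) ∪
      (Finset.range (N - 1)).map Nat.castEmbedding,
      ‖diagFun A k n (i + 1) - diagFun A k n i‖ₑ = 0 := by
    intro i hi
    simp only [Finset.mem_union, Finset.mem_insert, Finset.mem_singleton, Finset.mem_map,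
      Finset.mem_range, Nat.castEmbedding_apply, not_or, not_exists, not_and] at hi
    have h2 := hi.2 i.toNat
    rcases lt_or_ge i 0 with h | h
    · rw [hz' _ h, hz' _ (by omega)]
      simp
    · rw [hz _ (by omega), hz _ (by omega)]
      simp
  rw [tsum_eq_sum hs, ENNReal.ofReal_add (by positivity) (by positivity)]
  refine (le_of_le_of_eq le_self_add (Finset.sum_union_inter ..)).trans (add_le_add ?_ ?_)
  · have h1 : ∀ i ∈ ({-1, (N : ℤ) - 1} : Finset ℤ),
        ‖diagFun A k n (i + 1) - diagFun A k n i‖ₑ ≤ C := by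
      intro i hi
      simp only [Finset.mem_insert, Finset.mem_singleton] at hi
      rcases hi with rfl | rfl
      · rw [hz' (-1) (by norm_num), sub_zero]
        exact enorm_diagFun_le hC _ _ _
      · rw [hz ((N : ℤ) - 1 + 1) (by omega), zero_sub, enorm_neg]
        exact enorm_diagFun_le hC _ _ _
    refine (Finset.sum_le_card_nsmul _ _ _ h1).trans ?_
    rw [nsmul_eq_mul, ENNReal.ofReal_mul (by norm_num), ENNReal.ofReal_coe_nnreal]
    gcongr
    rw [ENNReal.ofReal_ofNat]
    exact_mod_cast Finset.card_le_two
  · rw [Finset.sum_map, ENNReal.ofReal_sum_of_nonneg fun _ _ => norm_nonneg _]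
    refine Finset.sum_le_sum fun j _ => le_of_eq ?_
    rw [ofReal_norm]
    simp only [diagFun, Nat.castEmbedding_apply]
    rw [if_pos (by omega), if_pos (by omega)]
    simp

theorem slowlyVarying_rowFun {C : ℝ≥0} (hC : ∀ n a b, ‖A n a b‖ₑ ≤ C)
    (hA : VanishingMeanVariation A) (k : ℤ) : SlowlyVarying (rowFun A k) := by
  have := (slowlyVarying_diagFun hC hA k).shift (-((-k).toNat : ℤ))
  have h : rowFun A k = fun n i => diagFun A k n (i + (-((-k).toNat : ℤ))) := by
    funext n i
    exact rowFun_eq_diagFun_shift k n i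
  rwa [h]

/-- `diagSeq` drops position `k` when `k < -j`. For fixed `k` the mismatch is confined to `0 ≤ j <
-k`, a set independent of `n`. -/
theorem negligible_seqFun_sub_diagFun {C : ℝ≥0} (hC : ∀ n a b, ‖A n a b‖ₑ ≤ C) (k : ℤ) :
    Negligible fun n i => seqFun A k n i - diagFun A k n i := by
  refine Negligible.of_support (UniformlyBounded.sub ⟨C, enorm_seqFun_le hC k⟩
    ⟨C, enorm_diagFun_le hC k⟩) (Finset.Ico 0 (-k)) ?_
  intro n i hi
  simp only [Finset.mem_Ico, not_and, not_lt] at hi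
  unfold seqFun diagFun
  rw [diagSeq_apply]
  by_cases h0 : 0 ≤ i
  swap
  · rw [if_neg (by omega), if_neg h0, sub_zero]
  by_cases hn : diagEntry (A n) k i.toNat = 0
  · simp [hn]
  · have : i.toNat + (-k).toNat < n ∧ i.toNat + k.toNat < n := by
      by_contra hcon
      exact hn (dif_neg hcon)
    have := hi h0
    rw [if_pos (by omega), if_pos (by omega), if_pos h0, sub_self]

theorem negligible_rowFun_sub_seqFun {C : ℝ≥0} (hC : ∀ n a b, ‖A n a b‖ₑ ≤ C)
    (hA : VanishingMeanVariation A) (k : ℤ) :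
    Negligible fun n i => rowFun A k n i - seqFun A k n i := by
  have h1 := (slowlyVarying_diagFun hC hA k).shift_sub (-((-k).toNat : ℤ))
  have h2 := h1.sub (negligible_seqFun_sub_diagFun hC k)
  simp only [rowFun_eq_diagFun_shift]
  convert h2 using 3
  ring

/-- The entries of the `s`-th diagonal of the `m`-th power of the matrices restricted to `S`. -/
def powFun (A : MatrixSeq) (S : Finset ℤ) (m : ℕ) (s : ℤ) (n : ℕ) (i : ℤ) : ℂ :=
  extEntry (keepDiagonals (S : Set ℤ) (A n) ^ m) i (i + s)

theorem powFun_succ (S : Finset ℤ) (m : ℕ) (s : ℤ) (n : ℕ) (i : ℤ) :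
    powFun A S (m + 1) s n i = ∑ k ∈ S, rowFun A k n i * powFun A S m (s - k) n (i + k) := by
  unfold powFun rowFun
  rw [pow_succ', extEntry_keepDiagonals_mul]
  refine Finset.sum_congr rfl fun k _ => ?_
  rw [show i + k + (s - k) = i + s by ring]

theorem powFun_zero (S : Finset ℤ) (s : ℤ) (n : ℕ) (i : ℤ) :
    powFun A S 0 s n i = if (0 ≤ i ∧ i < n) ∧ s = 0 then 1 else 0 := by
  unfold powFun extEntry
  rw [pow_zero]
  split_ifs with h1 h2 h2
  · rw [Matrix.one_apply, if_pos]
    simp [h2.2]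
  · rw [Matrix.one_apply, if_neg]
    intro h
    rw [Fin.mk.injEq] at h
    omega
  · omega
  · rfl

/-- For `s = 0` this is the indicator of `[0, n)`, which jumps only twice; otherwise it vanishes. -/
theorem slowlyVarying_powFun_zero (S : Finset ℤ) (s : ℤ) : SlowlyVarying (powFun A S 0 s) := by
  refine Negligible.of_tsum_le_const (C := 2) fun n => ?_
  have hs : ∀ i ∉ ({-1, (n : ℤ) - 1} : Finset ℤ),
      ‖powFun A S 0 s n (i + 1) - powFun A S 0 s n i‖ₑ = 0 := by
    intro i hi
    simp only [Finset.mem_insert, Finset.mem_singleton, not_or] at hi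
    rw [powFun_zero, powFun_zero]
    have : ((0 ≤ i + 1 ∧ i + 1 < (n : ℤ)) ∧ s = 0) ↔ ((0 ≤ i ∧ i < (n : ℤ)) ∧ s = 0) := by omega
    simp [this]
  rw [tsum_eq_sum hs]
  refine (Finset.sum_le_card_nsmul _ _ 1 ?_).trans ?_
  · intro i _
    rw [powFun_zero, powFun_zero]
    split_ifs <;> simp
  · rw [nsmul_one]
    exact_mod_cast Finset.card_le_two

/-- Both properties go through the induction together, since a product of slowly varying functions
is slowly varying only under boundedness. -/
theorem powFun_bounded_slowlyVarying {C : ℝ≥0} (hC : ∀ n a b, ‖A n a b‖ₑ ≤ C)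
    (hA : VanishingMeanVariation A) (S : Finset ℤ) (m : ℕ) :
    ∀ s, UniformlyBounded (powFun A S m s) ∧ SlowlyVarying (powFun A S m s) := by
  induction m with
  | zero =>
    refine fun s => ⟨⟨1, fun n i => ?_⟩, slowlyVarying_powFun_zero S s⟩
    rw [powFun_zero]
    split_ifs <;> simp
  | succ m ih =>
    intro s
    have h : powFun A S (m + 1) s =
        fun n i => ∑ k ∈ S, rowFun A k n i * powFun A S m (s - k) n (i + k) := by
      funext n i
      exact powFun_succ S m s n i
    rw [h]
    constructor
    · exact UniformlyBounded.sum S fun k _ =>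
        (uniformlyBounded_rowFun hC k).mul ((ih (s - k)).1.shift k)
    · exact SlowlyVarying.sum S fun k _ => (slowlyVarying_rowFun hC hA k).mul
        ((ih (s - k)).2.shift k) (uniformlyBounded_rowFun hC k) ((ih (s - k)).1.shift k)

/-- The `convCoeff` of the sequences `diagSeq`, as functions on `ℤ`. -/
noncomputable def convFun (A : MatrixSeq) (S : Finset ℤ) (m : ℕ) (s : ℤ) (n : ℕ) (i : ℤ) : ℂ :=
  if 0 ≤ i ∧ i < n then convCoeff S m s (diagSeq (A n) i.toNat) else 0

theorem negligible_powFun_sub_convFun {C : ℝ≥0} (hC : ∀ n a b, ‖A n a b‖ₑ ≤ C)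
    (hA : VanishingMeanVariation A) (S : Finset ℤ) (m : ℕ) :
    ∀ s, Negligible fun n i => powFun A S m s n i - convFun A S m s n i := by
  induction m with
  | zero =>
    intro s
    have h : ∀ n i, powFun A S 0 s n i - convFun A S 0 s n i = 0 := by
      intro n i
      rw [powFun_zero]
      unfold convFun convCoeff
      split_ifs <;> simp_all
    simpa only [h] using Negligible.zero
  | succ m ih =>
    intro s
    have hS := powFun_bounded_slowlyVarying hC hA S m
    -- Three errors: moving the base point of the smaller power from `i + k` back to `i` (slow
    -- variation), replacing the matrix entry by the entry of `diagSeq`, and the induction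
    -- hypothesis.
    have h : ∀ n i, powFun A S (m + 1) s n i - convFun A S (m + 1) s n i =
        ∑ k ∈ S, (rowFun A k n i *
            (powFun A S m (s - k) n (i + k) - powFun A S m (s - k) n i) +
          (rowFun A k n i - seqFun A k n i) * powFun A S m (s - k) n i +
          seqFun A k n i * (powFun A S m (s - k) n i - convFun A S m (s - k) n i)) := by
      intro n i
      have hc : convFun A S (m + 1) s n i =
          ∑ k ∈ S, seqFun A k n i * convFun A S m (s - k) n i := by
        unfold convFun seqFun
        split_ifs
        · simp [convCoeff]
        · simp
      rw [powFun_succ, hc, ← Finset.sum_sub_distrib]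
      refine Finset.sum_congr rfl fun k _ => ?_
      ring
    simp only [h]
    refine Negligible.sum S fun k _ => ?_
    refine Negligible.add (Negligible.add ?_ ?_) ?_
    · exact Negligible.bounded_mul (uniformlyBounded_rowFun hC k) ((hS (s - k)).2.shift_sub k)
    · exact Negligible.mul_bounded (negligible_rowFun_sub_seqFun hC hA k) (hS (s - k)).1
    · exact Negligible.bounded_mul ⟨C, enorm_seqFun_le hC k⟩ (ih (s - k))

/-- The mean trace of a power of the matrices restricted to finitely many diagonals. -/
theorem tendsto_trace_keepDiagonals_pow_sub {C : ℝ≥0} (hC : ∀ n a b, ‖A n a b‖ₑ ≤ C)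
    (hA : VanishingMeanVariation A) (S : Finset ℤ) (m : ℕ) :
    Tendsto (fun n : ℕ => (n : ℂ)⁻¹ * ((keepDiagonals (S : Set ℤ) (A n) ^ m).trace -
      ∑ j ∈ Finset.range n, convCoeff S m 0 (diagSeq (A n) j))) atTop (𝓝 0) := by
  refine ((negligible_powFun_sub_convFun hC hA S m 0).tendsto_sum
    fun n => (Finset.range n).map Nat.castEmbedding).congr fun n => ?_
  rw [← sum_extEntry_diag]
  congr 1
  refine Finset.sum_congr rfl fun i hi => ?_
  simp only [Finset.mem_map, Finset.mem_range, Nat.castEmbedding_apply] at hi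
  obtain ⟨j, hj, rfl⟩ := hi
  unfold powFun convFun
  rw [add_zero, if_pos (by omega)]

end BandedSeq

/-! ### Traces of powers through eigenvalues, and their perturbation in the entrywise `ℓ¹` norm. -/

namespace Matrix

variable {ι : Type*} [Fintype ι]

section CharpolyRoots

variable [DecidableEq ι]

theorem det_sub_scalar_eq_prod_roots (B : Matrix ι ι ℂ) (r : ℂ) :
    (B - scalar ι r).det = (B.charpoly.roots.map fun l => l - r).prod := by
  have hs := IsAlgClosed.splits B.charpoly
  have h1 : (scalar ι r - B).det = (B.charpoly.roots.map fun l => r - l).prod := by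
    rw [← eval_charpoly, hs.eval_eq_prod_roots_of_monic B.charpoly_monic]
  have h2 : B.charpoly.roots.map (fun l => l - r) =
      (B.charpoly.roots.map fun l => r - l).map Neg.neg := by
    rw [Multiset.map_map]
    simp
  have h3 : Multiset.card B.charpoly.roots = Fintype.card ι := by
    rw [← hs.natDegree_eq_card_roots, charpoly_natDegree_eq_dim]
  rw [← neg_sub, det_neg, h1, h2, Multiset.prod_map_neg, Multiset.card_map, h3]

/-- Both sides are multiplicative in `p`, so linear factors suffice. Taking `p = c - X ^ m` for all
`c` yields the spectral mapping theorem with multiplicities. -/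
theorem det_aeval_eq_prod_roots (B : Matrix ι ι ℂ) (p : Polynomial ℂ) :
    (Polynomial.aeval B p).det = (B.charpoly.roots.map fun l => p.eval l).prod := by
  have h3 : Multiset.card B.charpoly.roots = Fintype.card ι := by
    rw [← (IsAlgClosed.splits B.charpoly).natDegree_eq_card_roots, charpoly_natDegree_eq_dim]
  have key : ∀ s : Multiset ℂ,
      (Polynomial.aeval B (s.map fun r => Polynomial.X - Polynomial.C r).prod).det =
        (B.charpoly.roots.map
          fun l => (s.map fun r => Polynomial.X - Polynomial.C r).prod.eval l).prod := by
    intro s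
    induction s using Multiset.induction_on with
    | empty => simp
    | cons r s ih =>
      simp only [Multiset.map_cons, Multiset.prod_cons, map_mul, det_mul, ih,
        Polynomial.eval_mul, Multiset.prod_map_mul]
      congr 1
      have := det_sub_scalar_eq_prod_roots B r
      simpa [algebraMap_eq_diagonal, Pi.algebraMap_def, scalar_apply] using this
  rw [(IsAlgClosed.splits p).eq_prod_roots, map_mul, det_mul, key]
  simp only [Polynomial.eval_mul, Multiset.prod_map_mul]
  congr 1
  simp [algebraMap_eq_diagonal, Pi.algebraMap_def, h3]

theorem roots_charpoly_pow (B : Matrix ι ι ℂ) (m : ℕ) :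
    (B ^ m).charpoly.roots = B.charpoly.roots.map (· ^ m) := by
  have h : (B ^ m).charpoly =
      ((B.charpoly.roots.map (· ^ m)).map fun l => Polynomial.X - Polynomial.C l).prod := by
    refine Polynomial.funext fun c => ?_
    have h1 := det_aeval_eq_prod_roots B (Polynomial.C c - Polynomial.X ^ m)
    rw [eval_charpoly, Polynomial.eval_multiset_prod, Multiset.map_map, Multiset.map_map]
    simpa [algebraMap_eq_diagonal, Pi.algebraMap_def, scalar_apply, Function.comp_def] using h1
  rw [h, Polynomial.roots_multiset_prod_X_sub_C]

theorem trace_pow_eq_sum_roots (B : Matrix ι ι ℂ) (m : ℕ) :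
    (B ^ m).trace = (B.charpoly.roots.map (· ^ m)).sum := by
  rw [trace_eq_sum_roots_charpoly, roots_charpoly_pow]

theorem norm_le_of_mem_roots_charpoly {B : Matrix ι ι ℂ} {M : ℝ}
    (hB : ∀ i, ∑ j, ‖B i j‖ ≤ M) {l : ℂ} (hl : l ∈ B.charpoly.roots) : ‖l‖ ≤ M := by
  have h1 : Module.End.HasEigenvalue (toLin' B) l := by
    rw [Module.End.hasEigenvalue_iff_isRoot_charpoly, charpoly_toLin']
    exact Polynomial.isRoot_of_mem_roots hl
  -- Gershgorin: `l` lies in a disc centred at `B k k` whose radius is the rest of the row sum.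
  obtain ⟨k, hk⟩ := eigenvalue_mem_ball h1
  rw [mem_closedBall_iff_norm] at hk
  refine le_trans ?_ (hB k)
  rw [← Finset.add_sum_erase _ _ (Finset.mem_univ k)]
  have := norm_le_norm_add_norm_sub' l (B k k)
  linarith

end CharpolyRoots

/-- The sum of the moduli of all entries. -/
noncomputable def entrySum (B : Matrix ι ι ℂ) : ℝ := ∑ i, ∑ j, ‖B i j‖

theorem entrySum_add_le (B D : Matrix ι ι ℂ) : entrySum (B + D) ≤ entrySum B + entrySum D := by
  unfold entrySum
  simp only [← Finset.sum_add_distrib]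
  gcongr
  exact norm_add_le _ _

theorem norm_trace_le_entrySum (B : Matrix ι ι ℂ) : ‖B.trace‖ ≤ entrySum B := by
  refine (norm_sum_le _ _).trans (Finset.sum_le_sum fun i _ => ?_)
  exact Finset.single_le_sum (f := fun j => ‖B i j‖) (fun j _ => norm_nonneg _)
    (Finset.mem_univ i)

theorem entrySum_mul_le_of_row {M : ℝ} (B D : Matrix ι ι ℂ) (hD : ∀ i, ∑ j, ‖D i j‖ ≤ M) :
    entrySum (B * D) ≤ entrySum B * M := by
  have h : entrySum (B * D) ≤ ∑ i, ∑ j, ∑ l, ‖B i l‖ * ‖D l j‖ := by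
    unfold entrySum
    gcongr with i _ j _
    rw [mul_apply]
    refine (norm_sum_le _ _).trans (le_of_eq ?_)
    simp
  refine h.trans ?_
  unfold entrySum
  rw [Finset.sum_mul]
  gcongr with i _
  rw [Finset.sum_comm, Finset.sum_mul]
  gcongr with l _
  rw [← Finset.mul_sum]
  gcongr
  exact hD l

theorem entrySum_transpose (B : Matrix ι ι ℂ) : entrySum Bᵀ = entrySum B :=
  Finset.sum_comm

theorem entrySum_mul_le_of_col {M : ℝ} (B D : Matrix ι ι ℂ) (hB : ∀ j, ∑ i, ‖B i j‖ ≤ M) :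
    entrySum (B * D) ≤ M * entrySum D := by
  rw [← entrySum_transpose, transpose_mul, mul_comm, ← entrySum_transpose D]
  exact entrySum_mul_le_of_row _ _ hB

theorem entrySum_mul_pow_le [DecidableEq ι] {M : ℝ} (B D : Matrix ι ι ℂ) (hD : ∀ i, ∑ j, ‖D i j‖ ≤ M)
    (hM : 0 ≤ M) (m : ℕ) : entrySum (B * D ^ m) ≤ entrySum B * M ^ m := by
  induction m with
  | zero => simp
  | succ m ih =>
    rw [pow_succ, ← mul_assoc, pow_succ, ← mul_assoc]
    exact (entrySum_mul_le_of_row _ _ hD).trans (mul_le_mul_of_nonneg_right ih hM)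

/-- In the telescoped difference `B` multiplies only from the left and `D` only from the right,
hence column sums for `B` and row sums for `D`. -/
theorem entrySum_pow_sub_pow_le [DecidableEq ι] {M : ℝ} (B D : Matrix ι ι ℂ) (hB : ∀ j, ∑ i, ‖B i j‖ ≤ M)
    (hD : ∀ i, ∑ j, ‖D i j‖ ≤ M) (hM : 0 ≤ M) (m : ℕ) :
    entrySum (B ^ (m + 1) - D ^ (m + 1)) ≤ (m + 1) * M ^ m * entrySum (B - D) := by
  induction m with
  | zero => simp
  | succ m ih =>
    have h : B ^ (m + 1 + 1) - D ^ (m + 1 + 1) =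
        B * (B ^ (m + 1) - D ^ (m + 1)) + (B - D) * D ^ (m + 1) := by
      rw [mul_sub, sub_mul, ← pow_succ', ← pow_succ']
      abel
    rw [h]
    refine (entrySum_add_le _ _).trans ((add_le_add ((entrySum_mul_le_of_col _ _ hB).trans
      (mul_le_mul_of_nonneg_left ih hM)) (entrySum_mul_pow_le _ _ hD hM _)).trans (le_of_eq ?_))
    push_cast
    ring

end Matrix

/-! ### Diagonal maxima and the reduction of traces to a band. -/

section Diagonals

variable {n : ℕ} (B : Matrix (Fin n) (Fin n) ℂ)

theorem norm_diagEntry_le_diagMax (k : ℤ) (j : ℕ) : ‖diagEntry B k j‖ ≤ diagMax B k := by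
  by_cases hj : j < n
  · exact_mod_cast Finset.le_sup (f := fun j => ‖diagEntry B k j‖₊) (Finset.mem_range.2 hj)
  · have : diagEntry B k j = 0 := dif_neg (by omega)
    rw [this, norm_zero]
    exact NNReal.coe_nonneg _

theorem diagEntry_sub (i j : Fin n) :
    diagEntry B ((j : ℤ) - i) (min (i : ℕ) j) = B i j := by
  rw [diagEntry_eq_extEntry, ← extEntry_coe B i j]
  congr 1 <;> omega

theorem norm_entry_le_diagMax (i j : Fin n) : ‖B i j‖ ≤ diagMax B ((j : ℤ) - i) := by
  rw [← diagEntry_sub B i j]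
  exact norm_diagEntry_le_diagMax _ _ _

theorem diagMaxSum_nonneg : 0 ≤ diagMaxSum B :=
  Finset.sum_nonneg fun _ _ => NNReal.coe_nonneg _

theorem sum_diagMax_le_of_injective (g : Fin n → ℤ) (hg : Function.Injective g)
    (h : ∀ i, g i ∈ Finset.Icc (-(n : ℤ)) n) : ∑ i, (diagMax B (g i) : ℝ) ≤ diagMaxSum B := by
  rw [← Finset.sum_image (f := fun k => (diagMax B k : ℝ)) (fun x _ y _ hxy => hg hxy)]
  refine Finset.sum_le_sum_of_subset_of_nonneg ?_ fun _ _ _ => NNReal.coe_nonneg _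
  intro k hk
  obtain ⟨i, _, rfl⟩ := Finset.mem_image.1 hk
  exact h i

theorem sum_row_le_diagMaxSum (i : Fin n) : ∑ j, ‖B i j‖ ≤ diagMaxSum B := by
  refine (Finset.sum_le_sum fun j _ => norm_entry_le_diagMax B i j).trans
    (sum_diagMax_le_of_injective B (fun j => (j : ℤ) - i) ?_ ?_)
  · intro a b hab
    simp only at hab
    exact Fin.ext (by omega)
  · intro j
    rw [Finset.mem_Icc]
    omega

theorem sum_col_le_diagMaxSum (j : Fin n) : ∑ i, ‖B i j‖ ≤ diagMaxSum B := by
  refine (Finset.sum_le_sum fun i _ => norm_entry_le_diagMax B i j).trans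
    (sum_diagMax_le_of_injective B (fun i => (j : ℤ) - i) ?_ ?_)
  · intro a b hab
    simp only at hab
    exact Fin.ext (by omega)
  · intro i
    rw [Finset.mem_Icc]
    omega

theorem norm_keepDiagonals_le (S : Set ℤ) [DecidablePred (· ∈ S)] (i j : Fin n) :
    ‖keepDiagonals S B i j‖ ≤ ‖B i j‖ := by
  simp only [keepDiagonals, Matrix.of_apply]
  split_ifs <;> simp

theorem keepDiagonals_of_mem {S : Set ℤ} [DecidablePred (· ∈ S)] {i j : Fin n}
    (h : (j : ℤ) - i ∈ S) : keepDiagonals S B i j = B i j := if_pos h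

theorem keepDiagonals_of_notMem {S : Set ℤ} [DecidablePred (· ∈ S)] {i j : Fin n}
    (h : (j : ℤ) - i ∉ S) : keepDiagonals S B i j = 0 := if_neg h

/-- A walk of `p` steps, each rising by at most `K`, cannot rise by more than `p * K`. -/
theorem keepDiagonals_pow_apply_eq_zero {K : ℕ} (p : ℕ) (i j : Fin n)
    (h : (p : ℤ) * K < (j : ℤ) - i) : (keepDiagonals (Set.Iic (K : ℤ)) B ^ p) i j = 0 := by
  induction p generalizing i with
  | zero =>
    rw [pow_zero, Matrix.one_apply, if_neg]
    rintro rfl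
    simp at h
  | succ p ih =>
    rw [pow_succ', Matrix.mul_apply]
    refine Finset.sum_eq_zero fun l _ => ?_
    by_cases hl : (l : ℤ) - i ≤ K
    · rw [ih l (by push_cast at h; linarith), mul_zero]
    · rw [keepDiagonals_of_notMem B (by rwa [Set.mem_Iic]), zero_mul]

/-- A step falling by more than `L` leaves a climb that the remaining steps, each of at most `K`,
cannot make; such walks contribute nothing. The hypothesis is arranged to survive removal of the
first step. -/
theorem keepDiagonals_pow_apply_eq {K L : ℕ} (p : ℕ) (i j : Fin n)
    (h : (p : ℤ) * K ≤ L + ((j : ℤ) - i)) :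
    (keepDiagonals (Set.Iic (K : ℤ)) B ^ p) i j =
      (keepDiagonals ((Finset.Icc (-(L : ℤ)) K : Finset ℤ) : Set ℤ) B ^ p) i j := by
  induction p generalizing i with
  | zero => simp
  | succ p ih =>
    rw [pow_succ', Matrix.mul_apply, pow_succ', Matrix.mul_apply]
    refine Finset.sum_congr rfl fun l _ => ?_
    push_cast at h
    by_cases hl : (l : ℤ) - i ≤ K
    · by_cases hl' : -(L : ℤ) ≤ (l : ℤ) - i
      · rw [ih l (by linarith), keepDiagonals_of_mem B (Set.mem_Iic.2 hl),
          keepDiagonals_of_mem B (Finset.mem_coe.2 (Finset.mem_Icc.2 ⟨hl', hl⟩))]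
      · rw [keepDiagonals_pow_apply_eq_zero B p l j (by linarith), mul_zero,
          keepDiagonals_of_notMem B fun h => hl' (Finset.mem_Icc.1 h).1, zero_mul]
    · rw [keepDiagonals_of_notMem B (by rwa [Set.mem_Iic]), zero_mul,
        keepDiagonals_of_notMem B fun h => hl (Finset.mem_Icc.1 h).2, zero_mul]

theorem trace_keepDiagonals_pow_eq {K L : ℕ} (p : ℕ) (h : p * K ≤ L) :
    (keepDiagonals (Set.Iic (K : ℤ)) B ^ p).trace =
      (keepDiagonals ((Finset.Icc (-(L : ℤ)) K : Finset ℤ) : Set ℤ) B ^ p).trace := by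
  refine Finset.sum_congr rfl fun i _ => keepDiagonals_pow_apply_eq B p i i ?_
  rw [sub_self, add_zero]
  exact_mod_cast h

/-- Discarding the diagonals far below the main one does not change the trace of a power if the
diagonals far above it are discarded, too. -/
theorem norm_trace_pow_sub_trace_keepDiagonals_pow_le {M : ℝ} (hM : diagMaxSum B ≤ M)
    (K m : ℕ) :
    ‖(B ^ (m + 1)).trace - (keepDiagonals
      ((Finset.Icc (-(((m + 1) * K : ℕ) : ℤ)) K : Finset ℤ) : Set ℤ) B ^ (m + 1)).trace‖ ≤
      (m + 1) * M ^ m * Matrix.entrySum (B - keepDiagonals (Set.Iic (K : ℤ)) B) := by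
  rw [← trace_keepDiagonals_pow_eq B (m + 1) le_rfl, ← Matrix.trace_sub]
  refine (Matrix.norm_trace_le_entrySum _).trans (Matrix.entrySum_pow_sub_pow_le _ _
    (fun j => (sum_col_le_diagMaxSum B j).trans hM) (fun i => ?_)
    ((diagMaxSum_nonneg B).trans hM) m)
  exact (Finset.sum_le_sum fun j _ => norm_keepDiagonals_le B _ i j).trans
    ((sum_row_le_diagMaxSum B i).trans hM)

end Diagonals

/-! ### Upper tails of summable sequences. -/

namespace EllOne

theorem hasSum_norm (z : EllOne) : HasSum (fun k => ‖z k‖) ‖z‖ := by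
  simpa using lp.hasSum_norm (p := 1) (by norm_num) z

theorem continuous_apply (k : ℤ) : Continuous fun z : EllOne => z k :=
  (lp.lipschitzWith_one_eval 1 k).continuous

theorem norm_apply_le (z : EllOne) (k : ℤ) : ‖z k‖ ≤ ‖z‖ :=
  lp.norm_apply_le_norm one_ne_zero z k

/-- The sum of the moduli of the terms with index above `K`. -/
noncomputable def upperTail (K : ℕ) (z : EllOne) : ℝ :=
  ∑' k : ℤ, (Set.Ioi (K : ℤ)).indicator (fun k => ‖z k‖) k

theorem summable_upperTail (K : ℕ) (z : EllOne) :
    Summable fun k : ℤ => (Set.Ioi (K : ℤ)).indicator (fun k => ‖z k‖) k :=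
  z.hasSum_norm.summable.indicator _

theorem upperTail_nonneg (K : ℕ) (z : EllOne) : 0 ≤ upperTail K z :=
  tsum_nonneg fun k => Set.indicator_nonneg (fun _ _ => norm_nonneg _) k

theorem upperTail_le_norm (K : ℕ) (z : EllOne) : upperTail K z ≤ ‖z‖ := by
  rw [← z.hasSum_norm.tsum_eq]
  exact (summable_upperTail K z).tsum_le_tsum
    (fun k => Set.indicator_le_self' (fun _ _ => norm_nonneg _) k) z.hasSum_norm.summable

theorem upperTail_add_le (K : ℕ) (z w : EllOne) :
    upperTail K (z + w) ≤ upperTail K z + upperTail K w := by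
  unfold upperTail
  rw [← (summable_upperTail K z).tsum_add (summable_upperTail K w)]
  refine (summable_upperTail K _).tsum_le_tsum (fun k => ?_)
    ((summable_upperTail K z).add (summable_upperTail K w))
  by_cases hk : k ∈ Set.Ioi (K : ℤ)
  · simp only [Set.indicator_of_mem hk]
    exact norm_add_le _ _
  · simp [Set.indicator_of_notMem hk]

theorem continuous_upperTail (K : ℕ) : Continuous (upperTail K) := by
  refine (LipschitzWith.of_le_add fun z w => ?_).continuous
  have h := upperTail_add_le K w (z - w)
  rw [add_sub_cancel] at h
  refine h.trans (add_le_add le_rfl ?_)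
  rw [dist_eq_norm]
  exact upperTail_le_norm K _

theorem tendsto_upperTail (z : EllOne) : Tendsto (fun K => upperTail K z) atTop (𝓝 0) := by
  have h := tendsto_tsum_of_dominated_convergence (𝓕 := atTop)
    (f := fun (K : ℕ) (k : ℤ) => (Set.Ioi (K : ℤ)).indicator (fun k => ‖z k‖) k)
    (g := fun _ => 0) z.hasSum_norm.summable ?_ ?_
  · rwa [tsum_zero] at h
  · intro k
    refine tendsto_const_nhds.congr' ?_
    filter_upwards [eventually_ge_atTop k.toNat] with K hK
    rw [Set.indicator_of_notMem]
    simp only [Set.mem_Ioi, not_lt]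
    omega
  · refine Eventually.of_forall fun K k => ?_
    rw [Real.norm_of_nonneg (Set.indicator_nonneg (fun _ _ => norm_nonneg _) k)]
    exact Set.indicator_le_self' (fun _ _ => norm_nonneg _) k

end EllOne

/-! ### Norms and tails of the sequences `a_j(n)`. -/

section DiagSeq

variable {n : ℕ} (B : Matrix (Fin n) (Fin n) ℂ)

theorem norm_diagSeq_le {j : ℕ} (hj : j ≤ n) : ‖diagSeq B j‖ ≤ diagMaxSum B := by
  refine lp.norm_le_of_forall_sum_le (by norm_num) (diagMaxSum_nonneg B) fun s => ?_
  simp only [ENNReal.toReal_one, Real.rpow_one]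
  have hz : ∀ k ∉ Finset.Icc (-(n : ℤ)) n, ‖diagSeq B j k‖ = 0 := by
    intro k hk
    rw [diagSeq_apply, if_neg, norm_zero]
    rw [Finset.mem_Icc] at hk
    omega
  calc ∑ k ∈ s, ‖diagSeq B j k‖ ≤ ∑ k ∈ s ∪ Finset.Icc (-(n : ℤ)) n, ‖diagSeq B j k‖ :=
        Finset.sum_le_sum_of_subset_of_nonneg Finset.subset_union_left fun _ _ _ => norm_nonneg _
    _ = ∑ k ∈ Finset.Icc (-(n : ℤ)) n, ‖diagSeq B j k‖ :=
        (Finset.sum_subset Finset.subset_union_right fun k _ hk => hz k hk).symm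
    _ ≤ diagMaxSum B := by
        refine Finset.sum_le_sum fun k _ => ?_
        rw [diagSeq_apply]
        split_ifs
        · exact norm_diagEntry_le_diagMax B k j
        · simp

/-- The averages in `IsMuDistributed` include `j = n`, which is not a row of the matrix; this
surplus term is a constant and disappears after division by `n`. -/
theorem diagSeq_self : diagSeq B n = 0 := by
  ext k
  rw [diagSeq_apply]
  split_ifs
  · exact dif_neg (by omega)
  · rfl

/-- On and above the main diagonal, `diagSeq B i` lists row `i` without omissions. This fails below
it, which is why only upper diagonals are cut here. -/
theorem entrySum_sub_keepDiagonals_le (K : ℕ) :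
    Matrix.entrySum (B - keepDiagonals (Set.Iic (K : ℤ)) B) ≤
      ∑ j ∈ Finset.range n, EllOne.upperTail K (diagSeq B j) := by
  rw [Finset.sum_range]
  refine Finset.sum_le_sum fun i _ => ?_
  have hinj : Function.Injective fun j : Fin n => (j : ℤ) - i := by
    intro a b hab
    simp only at hab
    exact Fin.ext (by omega)
  have h : ∀ j : Fin n, ‖(B - keepDiagonals (Set.Iic (K : ℤ)) B) i j‖ =
      (Set.Ioi (K : ℤ)).indicator (fun k => ‖diagSeq B i k‖) ((j : ℤ) - i) := by
    intro j
    rw [Matrix.sub_apply]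
    by_cases hj : (j : ℤ) - i ≤ K
    · rw [keepDiagonals_of_mem B (Set.mem_Iic.2 hj), sub_self, norm_zero,
        Set.indicator_of_notMem (by simpa using hj)]
    · rw [keepDiagonals_of_notMem B (by rwa [Set.mem_Iic]), sub_zero,
        Set.indicator_of_mem (Set.mem_Ioi.2 (not_le.1 hj)), diagSeq_apply, if_pos (by omega),
        ← diagEntry_sub B i j, min_eq_left (by omega)]
  simp_rw [h]
  rw [← Finset.sum_image (f := fun k => (Set.Ioi (K : ℤ)).indicator
    (fun k => ‖diagSeq B i k‖) k) (fun x _ y _ hxy => hinj hxy)]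
  exact (EllOne.summable_upperTail K _).sum_le_tsum _
    fun k _ => Set.indicator_nonneg (fun _ _ => norm_nonneg _) k

end DiagSeq

/-! ### Weak convergence tested on functions bounded on the ball of radius `M`. -/

section MuDistributed

variable [MeasurableSpace EllOne] [BorelSpace EllOne] {A : MatrixSeq} {X : Set EllOne}
  {μ : Measure X} {M : ℝ}

/-- The test function vanishes on the closed ball of radius `M`, which contains every `a_j(n)`, and
is positive outside; its `μ`-integral is therefore `0`. -/
theorem IsMuDistributed.ae_norm_le [IsFiniteMeasure μ] (hμ : IsMuDistributed A X μ)
    (hM : ∀ n, diagMaxSum (A n) ≤ M) : ∀ᵐ z : X ∂μ, ‖(z : EllOne)‖ ≤ M := by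
  have hcont : Continuous fun z : EllOne => min 1 (max 0 (‖z‖ - M)) := by fun_prop
  let f : EllOne →ᵇ ℝ := BoundedContinuousFunction.ofNormedAddCommGroup
    (fun z => min 1 (max 0 (‖z‖ - M))) hcont 1 fun z => by
      rw [Real.norm_of_nonneg (by positivity)]
      exact min_le_left _ _
  have h0 : ∀ n, ∑ j ∈ Finset.range (n + 1), f (diagSeq (A n) j) = 0 := fun n => by
    refine Finset.sum_eq_zero fun j hj => ?_
    have h := (norm_diagSeq_le (A n) (Nat.lt_succ_iff.1 (Finset.mem_range.1 hj))).trans (hM n)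
    change min 1 (max 0 (‖diagSeq (A n) j‖ - M)) = 0
    rw [max_eq_left (by linarith), min_eq_right zero_le_one]
  have h := hμ f
  simp only [h0, mul_zero] at h
  have hint : ∫ z : X, f z ∂μ = 0 := tendsto_nhds_unique h tendsto_const_nhds
  have hi : Integrable (fun z : X => f z) μ := by
    refine Integrable.of_bound (C := 1) ?_ (Eventually.of_forall fun z => ?_)
    · exact (hcont.comp continuous_subtype_val).aestronglyMeasurable
    · change ‖min 1 (max 0 (‖(z : EllOne)‖ - M))‖ ≤ 1
      rw [Real.norm_of_nonneg (by positivity)]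
      exact min_le_left _ _
  have hnn : 0 ≤ fun z : X => f z := fun z => le_min zero_le_one (le_max_left _ _)
  rw [integral_eq_zero_iff_of_nonneg hnn hi] at hint
  filter_upwards [hint] with z hz
  change min 1 (max 0 (‖(z : EllOne)‖ - M)) = 0 at hz
  by_contra hcon
  rw [not_le] at hcon
  have : 0 < min 1 (max 0 (‖(z : EllOne)‖ - M)) :=
    lt_min one_pos (lt_max_of_lt_right (by linarith))
  linarith

/-- Clamping `f` to `[-C, C]` makes it an admissible test function and changes nothing on the ball
that carries both the `a_j(n)` and `μ`. -/
theorem IsMuDistributed.tendsto_real [IsFiniteMeasure μ] (hμ : IsMuDistributed A X μ)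
    (hM : ∀ n, diagMaxSum (A n) ≤ M) {f : EllOne → ℝ} (hf : Continuous f) {C : ℝ}
    (hC : ∀ z, ‖z‖ ≤ M → |f z| ≤ C) :
    Tendsto (fun n : ℕ => (n : ℝ)⁻¹ * ∑ j ∈ Finset.range n, f (diagSeq (A n) j)) atTop
      (𝓝 (∫ z : X, f z ∂μ)) := by
  have hC0 : 0 ≤ C := (abs_nonneg _).trans
    (hC 0 (by rw [norm_zero]; exact (diagMaxSum_nonneg (A 0)).trans (hM 0)))
  have hcont : Continuous fun z => max (-C) (min C (f z)) := by fun_prop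
  let g : EllOne →ᵇ ℝ := BoundedContinuousFunction.ofNormedAddCommGroup
    (fun z => max (-C) (min C (f z))) hcont C fun z => by
      rw [Real.norm_eq_abs, abs_le]
      exact ⟨le_max_left _ _, max_le (by linarith) (min_le_left _ _)⟩
  have hg : ∀ z, ‖z‖ ≤ M → g z = f z := fun z hz => by
    have := abs_le.1 (hC z hz)
    change max (-C) (min C (f z)) = f z
    rw [min_eq_right this.2, max_eq_right this.1]
  have h := hμ g
  have hint : ∫ z : X, g z ∂μ = ∫ z : X, f z ∂μ := by
    refine integral_congr_ae ?_
    filter_upwards [hμ.ae_norm_le hM] with z hz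
    exact hg z hz
  rw [hint] at h
  have h0 : Tendsto (fun n : ℕ => (n : ℝ)⁻¹ * g 0) atTop (𝓝 0) := by
    simpa using (tendsto_inv_atTop_nhds_zero_nat (𝕜 := ℝ)).mul_const (g 0)
  have h' := h.sub h0
  rw [sub_zero] at h'
  refine h'.congr fun n => ?_
  rw [Finset.sum_range_succ, diagSeq_self, mul_add, add_sub_cancel_right]
  congr 1
  refine Finset.sum_congr rfl fun j hj => hg _ ?_
  exact (norm_diagSeq_le (A n) (Finset.mem_range.1 hj).le).trans (hM n)

theorem IsMuDistributed.tendsto_complex [IsFiniteMeasure μ] (hμ : IsMuDistributed A X μ)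
    (hM : ∀ n, diagMaxSum (A n) ≤ M) {f : EllOne → ℂ} (hf : Continuous f) {C : ℝ}
    (hC : ∀ z, ‖z‖ ≤ M → ‖f z‖ ≤ C) :
    Tendsto (fun n : ℕ => (n : ℂ)⁻¹ * ∑ j ∈ Finset.range n, f (diagSeq (A n) j)) atTop
      (𝓝 (∫ z : X, f z ∂μ)) := by
  have hi : Integrable (fun z : X => f z) μ := by
    refine Integrable.of_bound (C := C)
      (hf.comp continuous_subtype_val).aestronglyMeasurable ?_
    filter_upwards [hμ.ae_norm_le hM] with z hz
    exact hC z hz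
  have hre := hμ.tendsto_real hM (Complex.continuous_re.comp hf)
    fun z hz => (Complex.abs_re_le_norm _).trans (hC z hz)
  have him := hμ.tendsto_real hM (Complex.continuous_im.comp hf)
    fun z hz => (Complex.abs_im_le_norm _).trans (hC z hz)
  have h := ((Complex.continuous_ofReal.tendsto _).comp hre).add
    (((Complex.continuous_ofReal.tendsto _).comp him).mul_const Complex.I)
  have hlim : ((∫ z : X, (f z).re ∂μ : ℝ) : ℂ) + ((∫ z : X, (f z).im ∂μ : ℝ) : ℂ) * Complex.I =
      ∫ z : X, f z ∂μ := by
    exact integral_re_add_im hi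
  change Tendsto _ _ (𝓝 (((∫ z : X, (f z).re ∂μ : ℝ) : ℂ) +
    ((∫ z : X, (f z).im ∂μ : ℝ) : ℂ) * Complex.I)) at h
  rw [hlim] at h
  refine h.congr fun n => ?_
  simp only [Function.comp_apply]
  push_cast
  rw [mul_assoc, ← mul_add, Finset.sum_mul, ← Finset.sum_add_distrib]
  simp only [Complex.re_add_im]

end MuDistributed

/-! ### Fourier sums and convolution powers. -/

section Fourier

theorem norm_exp_I_mul_int_mul (k : ℤ) (t : ℝ) :
    ‖Complex.exp (Complex.I * (k : ℂ) * (t : ℂ))‖ = 1 := by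
  have h : Complex.I * (k : ℂ) * (t : ℂ) = ((k * t : ℝ) : ℂ) * Complex.I := by
    push_cast
    ring
  rw [h, Complex.norm_exp_ofReal_mul_I]

/-- The partial sum over `S` of the Fourier series of `z`. -/
noncomputable def fourierSum (S : Finset ℤ) (z : EllOne) (t : ℝ) : ℂ :=
  ∑ k ∈ S, z k * Complex.exp (Complex.I * (k : ℂ) * (t : ℂ))

theorem norm_fourier_term (z : EllOne) (t : ℝ) (k : ℤ) :
    ‖z k * Complex.exp (Complex.I * (k : ℂ) * (t : ℂ))‖ = ‖z k‖ := by
  rw [norm_mul, norm_exp_I_mul_int_mul, mul_one]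

theorem hasSum_fourierF (z : EllOne) (t : ℝ) :
    HasSum (fun k : ℤ => z k * Complex.exp (Complex.I * (k : ℂ) * (t : ℂ))) (fourierF z t) :=
  (Summable.of_norm (by simpa only [norm_fourier_term] using z.hasSum_norm.summable)).hasSum

theorem norm_fourierF_le (z : EllOne) (t : ℝ) : ‖fourierF z t‖ ≤ ‖z‖ :=
  tsum_of_norm_bounded z.hasSum_norm fun k => (norm_fourier_term z t k).le

theorem norm_fourierSum_le (S : Finset ℤ) (z : EllOne) (t : ℝ) : ‖fourierSum S z t‖ ≤ ‖z‖ := by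
  refine (norm_sum_le _ _).trans ?_
  simp only [norm_fourier_term]
  exact sum_le_hasSum S (fun _ _ => norm_nonneg _) z.hasSum_norm

theorem continuous_fourierSum (S : Finset ℤ) :
    Continuous fun p : EllOne × ℝ => fourierSum S p.1 p.2 := by
  unfold fourierSum
  refine continuous_finsetSum _ fun k _ => ?_
  exact ((EllOne.continuous_apply k).comp continuous_fst).mul (by fun_prop)

theorem tendsto_fourierSum {S : ℕ → Finset ℤ} (hS : Tendsto S atTop atTop) (z : EllOne) (t : ℝ) :
    Tendsto (fun K => fourierSum (S K) z t) atTop (𝓝 (fourierF z t)) :=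
  (hasSum_fourierF z t).comp (SummationFilter.unconditional_filter ℤ ▸ hS)

/-- The lopsided window is the one dictated by `trace_keepDiagonals_pow_eq` for exponent `m + 1`. -/
theorem tendsto_Icc_neg_mul_atTop (m : ℕ) :
    Tendsto (fun K : ℕ => Finset.Icc (-(((m + 1) * K : ℕ) : ℤ)) K) atTop atTop := by
  refine tendsto_atTop_finset_of_monotone ?_ ?_
  · intro K L hKL
    refine Finset.Icc_subset_Icc ?_ (by exact_mod_cast hKL)
    rw [neg_le_neg_iff]
    exact_mod_cast Nat.mul_le_mul_left _ hKL
  · intro k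
    refine ⟨k.natAbs, Finset.mem_Icc.2 ⟨?_, by omega⟩⟩
    have : k.natAbs ≤ (m + 1) * k.natAbs := Nat.le_mul_of_pos_left _ (Nat.succ_pos m)
    omega

theorem integral_exp_int (s : ℤ) :
    ∫ t in (-Real.pi)..Real.pi, Complex.exp (-(Complex.I * (s : ℂ) * (t : ℂ))) =
      2 * Real.pi * if s = 0 then 1 else 0 := by
  split_ifs with hs
  · subst hs
    simp
    ring
  · have hc : -(Complex.I * (s : ℂ)) ≠ 0 :=
      neg_ne_zero.2 (mul_ne_zero Complex.I_ne_zero (by exact_mod_cast hs))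
    have h := integral_exp_mul_complex (a := -Real.pi) (b := Real.pi) hc
    simp only [neg_mul] at h
    rw [h, mul_zero, div_eq_zero_iff]
    left
    rw [sub_eq_zero, Complex.exp_eq_exp_iff_exists_int]
    refine ⟨-s, ?_⟩
    push_cast
    ring

/-- Splitting off one factor of the power replaces the frequency `s` by `s - k`, which is the
recursion defining `convCoeff`; orthogonality of exponentials starts the induction. -/
theorem integral_fourierSum_pow (S : Finset ℤ) (z : EllOne) (m : ℕ) (s : ℤ) :
    ∫ t in (-Real.pi)..Real.pi,
      fourierSum S z t ^ m * Complex.exp (-(Complex.I * (s : ℂ) * (t : ℂ))) =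
      2 * Real.pi * convCoeff S m s z := by
  have hF : Continuous fun t : ℝ => fourierSum S z t :=
    (continuous_fourierSum S).comp (Continuous.prodMk_right z)
  induction m generalizing s with
  | zero => simpa [convCoeff] using integral_exp_int s
  | succ m ih =>
    have h : ∀ t : ℝ, fourierSum S z t ^ (m + 1) * Complex.exp (-(Complex.I * (s : ℂ) * (t : ℂ))) =
        ∑ k ∈ S, z k * (fourierSum S z t ^ m *
          Complex.exp (-(Complex.I * ((s - k : ℤ) : ℂ) * (t : ℂ)))) := by
      intro t
      rw [pow_succ', mul_assoc]
      nth_rewrite 1 [fourierSum]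
      rw [Finset.sum_mul]
      refine Finset.sum_congr rfl fun k _ => ?_
      have he : Complex.exp (-(Complex.I * ((s - k : ℤ) : ℂ) * (t : ℂ))) =
          Complex.exp (Complex.I * (k : ℂ) * (t : ℂ)) *
            Complex.exp (-(Complex.I * (s : ℂ) * (t : ℂ))) := by
        rw [← Complex.exp_add]
        congr 1
        push_cast
        ring
      rw [he]
      ring
    simp_rw [h]
    rw [intervalIntegral.integral_finsetSum fun k _ =>
      Continuous.intervalIntegrable (by fun_prop) _ _]
    simp_rw [intervalIntegral.integral_const_mul, ih, convCoeff, Finset.mul_sum]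
    refine Finset.sum_congr rfl fun k _ => ?_
    ring

theorem norm_convCoeff_le (S : Finset ℤ) (m : ℕ) (s : ℤ) (z : EllOne) :
    ‖convCoeff S m s z‖ ≤ ‖z‖ ^ m := by
  induction m generalizing s with
  | zero =>
    unfold convCoeff
    split_ifs <;> simp
  | succ m ih =>
    unfold convCoeff
    refine (norm_sum_le _ _).trans ?_
    calc ∑ k ∈ S, ‖z k * convCoeff S m (s - k) z‖ ≤ ∑ k ∈ S, ‖z k‖ * ‖z‖ ^ m := by
          gcongr with k _
          rw [norm_mul]
          gcongr
          exact ih _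
      _ ≤ ‖z‖ ^ (m + 1) := by
          rw [← Finset.sum_mul, pow_succ']
          gcongr
          exact sum_le_hasSum S (fun _ _ => norm_nonneg _) z.hasSum_norm

theorem continuous_convCoeff (S : Finset ℤ) (m : ℕ) (s : ℤ) :
    Continuous fun z : EllOne => convCoeff S m s z := by
  induction m generalizing s with
  | zero =>
    unfold convCoeff
    exact continuous_const
  | succ m ih =>
    unfold convCoeff
    exact continuous_finsetSum _ fun k _ => (EllOne.continuous_apply k).mul (ih _)

end Fourier

/-- Interchange of limits by an `ε / 3` argument. It serves twice: with `K` a truncation level, and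
with `K` the index of an approximating polynomial. -/
theorem tendsto_of_approx {a : ℕ → ℂ} {b : ℕ → ℕ → ℂ} {d : ℕ → ℕ → ℝ} {I : ℕ → ℂ} {T : ℕ → ℝ}
    {L : ℂ} (hab : ∀ K n, ‖a n - b K n‖ ≤ d K n) (hb : ∀ K, Tendsto (b K) atTop (𝓝 (I K)))
    (hd : ∀ K, Tendsto (d K) atTop (𝓝 (T K))) (hI : Tendsto I atTop (𝓝 L))
    (hT : Tendsto T atTop (𝓝 0)) : Tendsto a atTop (𝓝 L) := by
  rw [Metric.tendsto_nhds]
  intro ε hε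
  obtain ⟨K, hK1, hK2⟩ := ((Metric.tendsto_nhds.1 hI (ε / 3) (by positivity)).and
    (hT.eventually_lt_const (show (0 : ℝ) < ε / 3 by positivity))).exists
  filter_upwards [Metric.tendsto_nhds.1 (hb K) (ε / 3) (by positivity),
    (hd K).eventually_lt_const hK2] with n hn1 hn2
  have h1 := hab K n
  rw [← dist_eq_norm] at h1
  have h2 := dist_triangle4 (a n) (b K n) (I K) L
  linarith

/-! ### Convergence of the moments. -/

section Moments

variable [MeasurableSpace EllOne] {A : MatrixSeq} {X : Set EllOne} {μ : Measure X} {M : ℝ}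

/-- The product of `μ` with Lebesgue measure on `(-π, π]`. -/
noncomputable abbrev prodCircle (μ : Measure X) : Measure (X × ℝ) :=
  μ.prod (volume.restrict (Set.Ioc (-Real.pi) Real.pi))

theorem ae_prodCircle {P : X → Prop} [SFinite μ] (h : ∀ᵐ z ∂μ, P z) :
    ∀ᵐ p ∂(prodCircle μ), P p.1 :=
  Measure.quasiMeasurePreserving_fst.ae h

theorem integral_prodCircle_const [IsProbabilityMeasure μ] (c : ℂ) :
    (2 * (Real.pi : ℂ))⁻¹ * ∫ _ : X × ℝ, c ∂(prodCircle μ) = c := by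
  have h : (prodCircle μ).real Set.univ = 2 * Real.pi := by
    rw [← Set.univ_prod_univ, measureReal_prod_prod, probReal_univ, one_mul,
      measureReal_restrict_apply_univ, Real.volume_real_Ioc_of_le (by linarith [Real.pi_pos])]
    ring
  rw [integral_const, h, Complex.real_smul, ← mul_assoc]
  push_cast
  rw [inv_mul_cancel₀, one_mul]
  exact mul_ne_zero two_ne_zero (by exact_mod_cast Real.pi_ne_zero)

variable [BorelSpace EllOne]

theorem measurable_fourierSum (S : Finset ℤ) :
    Measurable fun p : X × ℝ => fourierSum S p.1 p.2 :=
  ((continuous_fourierSum S).comp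
    ((continuous_subtype_val.comp continuous_fst).prodMk continuous_snd)).measurable

theorem measurable_fourierF : Measurable fun p : X × ℝ => fourierF p.1 p.2 :=
  measurable_of_tendsto_metrizable
    -- With `m = 0` the windows are the symmetric ones, `[-K, K]`.
    (fun K : ℕ => measurable_fourierSum (Finset.Icc (-(((0 + 1) * K : ℕ) : ℤ)) K))
    (tendsto_pi_nhds.2 fun p => tendsto_fourierSum (tendsto_Icc_neg_mul_atTop 0) p.1 p.2)

theorem integral_convCoeff [IsFiniteMeasure μ] (hμ : ∀ᵐ z : X ∂μ, ‖(z : EllOne)‖ ≤ M)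
    (S : Finset ℤ) (m : ℕ) :
    ∫ z : X, convCoeff S m 0 z ∂μ =
      (2 * (Real.pi : ℂ))⁻¹ * ∫ p, fourierSum S p.1 p.2 ^ m ∂(prodCircle μ) := by
  have hi : Integrable (fun p : X × ℝ => fourierSum S p.1 p.2 ^ m) (prodCircle μ) := by
    refine Integrable.of_bound (C := M ^ m)
      ((measurable_fourierSum S).pow_const m).aestronglyMeasurable ?_
    filter_upwards [ae_prodCircle hμ] with p hp
    rw [norm_pow]
    exact pow_le_pow_left₀ (norm_nonneg _) ((norm_fourierSum_le S _ _).trans hp) m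
  rw [integral_prod _ hi, ← integral_const_mul]
  refine integral_congr_ae (Eventually.of_forall fun z => ?_)
  have h := integral_fourierSum_pow S z m 0
  simp only [Int.cast_zero, mul_zero, zero_mul, neg_zero, Complex.exp_zero, mul_one] at h
  rw [intervalIntegral.integral_of_le (by linarith [Real.pi_pos])] at h
  simp only
  rw [h, ← mul_assoc, inv_mul_cancel₀, one_mul]
  exact mul_ne_zero two_ne_zero (by exact_mod_cast Real.pi_ne_zero)

theorem tendsto_integral_fourierSum_pow [IsFiniteMeasure μ]
    (hμ : ∀ᵐ z : X ∂μ, ‖(z : EllOne)‖ ≤ M) {S : ℕ → Finset ℤ} (hS : Tendsto S atTop atTop)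
    (m : ℕ) :
    Tendsto (fun K => ∫ p, fourierSum (S K) p.1 p.2 ^ m ∂(prodCircle μ)) atTop
      (𝓝 (∫ p, fourierF p.1 p.2 ^ m ∂(prodCircle μ))) := by
  refine tendsto_integral_of_dominated_convergence (fun _ => M ^ m)
    (fun K => ((measurable_fourierSum (S K)).pow_const m).aestronglyMeasurable)
    (integrable_const _) (fun K => ?_) ?_
  · filter_upwards [ae_prodCircle hμ] with p hp
    rw [norm_pow]
    exact pow_le_pow_left₀ (norm_nonneg _) ((norm_fourierSum_le _ _ _).trans hp) m
  · exact Eventually.of_forall fun p => (tendsto_fourierSum hS p.1 p.2).pow m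

theorem tendsto_integral_upperTail [IsFiniteMeasure μ]
    (hμ : ∀ᵐ z : X ∂μ, ‖(z : EllOne)‖ ≤ M) :
    Tendsto (fun K => ∫ z : X, EllOne.upperTail K z ∂μ) atTop (𝓝 0) := by
  have h := tendsto_integral_of_dominated_convergence (μ := μ) (f := fun _ => (0 : ℝ))
    (F := fun K (z : X) => EllOne.upperTail K z) (fun _ => M)
    (fun K => ((EllOne.continuous_upperTail K).comp
      continuous_subtype_val).aestronglyMeasurable) (integrable_const _) (fun K => ?_)
    (Eventually.of_forall fun z => EllOne.tendsto_upperTail z)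
  · simpa using h
  · filter_upwards [hμ] with z hz
    rw [Real.norm_of_nonneg (EllOne.upperTail_nonneg K _)]
    exact (EllOne.upperTail_le_norm K _).trans hz

/-- The limit `n → ∞` is taken at a fixed truncation level `K`, where the banded theory applies;
afterwards `K → ∞` by dominated convergence with bounds in powers of `M`. -/
theorem tendsto_trace_pow_succ [IsFiniteMeasure μ] (hA : VanishingMeanVariation A)
    (hμ : IsMuDistributed A X μ) (hM : ∀ n, diagMaxSum (A n) ≤ M) (m : ℕ) :
    Tendsto (fun n : ℕ => (n : ℂ)⁻¹ * (A n ^ (m + 1)).trace) atTop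
      (𝓝 ((2 * (Real.pi : ℂ))⁻¹ * ∫ p, fourierF p.1 p.2 ^ (m + 1) ∂(prodCircle μ))) := by
  have hM0 : 0 ≤ M := (diagMaxSum_nonneg (A 0)).trans (hM 0)
  have hae := hμ.ae_norm_le hM
  have hC : ∀ n a b, ‖A n a b‖ₑ ≤ (M.toNNReal : ℝ≥0∞) := by
    intro n a b
    rw [← ofReal_norm]
    refine ENNReal.ofReal_le_ofReal ?_
    exact (Finset.single_le_sum (f := fun b => ‖A n a b‖) (fun _ _ => norm_nonneg _)
      (Finset.mem_univ b)).trans ((sum_row_le_diagMaxSum (A n) a).trans (hM n))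
  set S : ℕ → Finset ℤ := fun K => Finset.Icc (-(((m + 1) * K : ℕ) : ℤ)) K with hS
  refine tendsto_of_approx
    (b := fun K n => (n : ℂ)⁻¹ * (keepDiagonals (S K : Set ℤ) (A n) ^ (m + 1)).trace)
    (d := fun K n => (m + 1) * M ^ m *
      ((n : ℝ)⁻¹ * ∑ j ∈ Finset.range n, EllOne.upperTail K (diagSeq (A n) j)))
    (I := fun K => ∫ z : X, convCoeff (S K) (m + 1) 0 z ∂μ)
    (T := fun K => (m + 1) * M ^ m * ∫ z : X, EllOne.upperTail K z ∂μ) ?_ ?_ ?_ ?_ ?_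
  · intro K n
    rw [← mul_sub, norm_mul, norm_inv, Complex.norm_natCast, mul_left_comm]
    gcongr
    refine (norm_trace_pow_sub_trace_keepDiagonals_pow_le (A n) (hM n) K m).trans ?_
    gcongr
    exact entrySum_sub_keepDiagonals_le (A n) K
  · intro K
    have h1 := tendsto_trace_keepDiagonals_pow_sub hC hA (S K) (m + 1)
    have h2 := hμ.tendsto_complex hM (continuous_convCoeff (S K) (m + 1) 0) (C := M ^ (m + 1))
      fun z hz => (norm_convCoeff_le _ _ _ z).trans (pow_le_pow_left₀ (norm_nonneg _) hz _)
    have h3 := h1.add h2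
    rw [zero_add] at h3
    refine h3.congr fun n => ?_
    rw [← mul_add, sub_add_cancel]
  · intro K
    refine Tendsto.const_mul _ (hμ.tendsto_real hM (EllOne.continuous_upperTail K) (C := M) ?_)
    intro z hz
    rw [abs_of_nonneg (EllOne.upperTail_nonneg K z)]
    exact (EllOne.upperTail_le_norm K z).trans hz
  · simp_rw [integral_convCoeff hae]
    exact (tendsto_integral_fourierSum_pow hae (tendsto_Icc_neg_mul_atTop m) _).const_mul _
  · simpa using (tendsto_integral_upperTail hae).const_mul ((m + 1) * M ^ m)

theorem tendsto_trace_pow [IsProbabilityMeasure μ] (hA : VanishingMeanVariation A)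
    (hμ : IsMuDistributed A X μ) (hM : ∀ n, diagMaxSum (A n) ≤ M) (m : ℕ) :
    Tendsto (fun n : ℕ => (n : ℂ)⁻¹ * (A n ^ m).trace) atTop
      (𝓝 ((2 * (Real.pi : ℂ))⁻¹ * ∫ p, fourierF p.1 p.2 ^ m ∂(prodCircle μ))) := by
  cases m with
  | succ m => exact tendsto_trace_pow_succ hA hμ hM m
  | zero =>
    simp only [pow_zero, integral_prodCircle_const, Matrix.trace_one, Fintype.card_fin]
    refine tendsto_const_nhds.congr' ?_
    -- At `n = 0` the mean trace is `0` and not `1`.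
    filter_upwards [eventually_gt_atTop 0] with n hn
    rw [inv_mul_cancel₀ (by exact_mod_cast hn.ne')]

end Moments

/-! ### Uniform approximation by polynomials on a disc and on an interval. -/

section Approximation

/-- Functions continuous on a closed disc and analytic in its interior are uniform limits of
polynomials. -/
theorem exists_polynomial_near_of_analytic_ball {M : ℝ} (hM : 0 ≤ M) {φ : ℂ → ℂ}
    (hc : ContinuousOn φ (Metric.closedBall 0 M)) (ha : AnalyticOnNhd ℂ φ (Metric.ball 0 M))
    {ε : ℝ} (hε : 0 < ε) :
    ∃ p : Polynomial ℂ, ∀ z ∈ Metric.closedBall (0 : ℂ) M, ‖φ z - p.eval z‖ ≤ ε := by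
  rcases hM.eq_or_lt with rfl | hM
  · refine ⟨Polynomial.C (φ 0), fun z hz => ?_⟩
    have : z = 0 := by simpa using hz
    simp [this, hε.le]
  obtain ⟨δ, hδ, hφ⟩ := Metric.uniformContinuousOn_iff.1
    ((isCompact_closedBall (0 : ℂ) M).uniformContinuousOn_of_continuous hc) (ε / 2) (by positivity)
  -- The dilate `z ↦ φ (r * z)` is uniformly close to `φ` on the disc and is analytic on a larger
  -- disc, so its Taylor polynomials converge uniformly on the original one.
  obtain ⟨r, hr0, hr1, hrδ⟩ : ∃ r : ℝ, 0 < r ∧ r < 1 ∧ (1 - r) * M < δ := by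
    refine ⟨1 - min (1 / 2) (δ / (2 * M)), ?_, ?_, ?_⟩
    · have := min_le_left (1 / 2) (δ / (2 * M))
      linarith
    · have : 0 < min (1 / 2) (δ / (2 * M)) := by positivity
      linarith
    · have h1 := min_le_right (1 / 2) (δ / (2 * M))
      have h2 : δ / (2 * M) * M = δ / 2 := by field_simp
      nlinarith
  have hrM : r * M < M := by nlinarith
  -- The Cauchy series is taken on a circle of radius `R < M`, inside the domain of analyticity;
  -- uniform convergence holds on the ball of radius `R' < R`, which still contains `r * z`.
  obtain ⟨R, hR1, hR2⟩ := exists_between hrM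
  obtain ⟨R', hR'1, hR'2⟩ := exists_between hR1
  have hR'0 : 0 < R' := (by positivity : 0 < r * M).trans hR'1
  lift R' to ℝ≥0 using hR'0.le
  lift R to ℝ≥0 using (hR'0.trans hR'2).le
  have hps := DifferentiableOn.hasFPowerSeriesOnBall
    (ha.differentiableOn.mono (Metric.closedBall_subset_ball hR2))
    (by exact_mod_cast hR'0.trans hR'2 : 0 < R)
  set q := cauchyPowerSeries φ 0 R
  obtain ⟨n, hn⟩ := (Metric.tendstoUniformlyOn_iff.1
    (hps.tendstoUniformlyOn (by exact_mod_cast hR'2 : (R' : ℝ≥0∞) < R)) (ε / 2)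
    (by positivity)).exists
  refine ⟨∑ i ∈ Finset.range n, Polynomial.C (q.coeff i * (r : ℂ) ^ i) * Polynomial.X ^ i,
    fun z hz => ?_⟩
  have hz' : ‖z‖ ≤ M := by simpa using hz
  have hrz : ‖(r : ℂ) * z‖ ≤ r * M := by
    rw [norm_mul, Complex.norm_real, Real.norm_of_nonneg hr0.le]
    gcongr
  have h1 : dist (φ z) (φ (r * z)) < ε / 2 := by
    refine hφ z hz _ (by simpa using hrz.trans hrM.le) ?_
    rw [dist_eq_norm, show z - r * z = ((1 - r : ℝ) : ℂ) * z by push_cast; ring, norm_mul,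
      Complex.norm_real, Real.norm_of_nonneg (by linarith)]
    refine lt_of_le_of_lt ?_ hrδ
    exact mul_le_mul_of_nonneg_left hz' (by linarith)
  have h2 := hn (r * z) (by simpa using hrz.trans_lt hR'1)
  have h3 : q.partialSum n (r * z) = (∑ i ∈ Finset.range n,
      Polynomial.C (q.coeff i * (r : ℂ) ^ i) * Polynomial.X ^ i).eval z := by
    rw [FormalMultilinearSeries.partialSum, Polynomial.eval_finsetSum]
    refine Finset.sum_congr rfl fun i _ => ?_
    rw [FormalMultilinearSeries.apply_eq_pow_smul_coeff]
    simp only [smul_eq_mul, Polynomial.eval_mul, Polynomial.eval_C, Polynomial.eval_pow,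
      Polynomial.eval_X]
    ring
  rw [← h3, ← dist_eq_norm]
  rw [zero_add] at h2
  have := dist_triangle (φ z) (φ (r * z)) (q.partialSum n (r * z))
  linarith

theorem exists_polynomial_near_of_continuousOn_complex {a b : ℝ} {φ : ℝ → ℂ}
    (hc : ContinuousOn φ (Set.Icc a b)) {ε : ℝ} (hε : 0 < ε) :
    ∃ p : Polynomial ℂ, ∀ x ∈ Set.Icc a b, ‖φ x - p.eval (x : ℂ)‖ ≤ ε := by
  obtain ⟨p, hp⟩ := exists_polynomial_near_of_continuousOn a b (fun x => (φ x).re)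
    (Complex.continuous_re.comp_continuousOn hc) (ε / 2) (by positivity)
  obtain ⟨q, hq⟩ := exists_polynomial_near_of_continuousOn a b (fun x => (φ x).im)
    (Complex.continuous_im.comp_continuousOn hc) (ε / 2) (by positivity)
  refine ⟨p.map Complex.ofRealHom + Polynomial.C Complex.I * q.map Complex.ofRealHom,
    fun x hx => ?_⟩
  have he : ∀ u : Polynomial ℝ,
      (u.map Complex.ofRealHom).eval (x : ℂ) = ((u.eval x : ℝ) : ℂ) := fun u =>
    (Polynomial.eval_map_apply Complex.ofRealHom x)
  rw [Polynomial.eval_add, Polynomial.eval_mul, Polynomial.eval_C, he, he]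
  refine (Complex.norm_le_abs_re_add_abs_im _).trans ?_
  have h1 := hp x hx
  have h2 := hq x hx
  rw [abs_sub_comm] at h1 h2
  simp
  linarith

end Approximation

/-! ### From moments to test functions. -/

section Limit

theorem norm_inv_mul_sum_roots_le {n : ℕ} (B : Matrix (Fin n) (Fin n) ℂ) {φ ψ : ℂ → ℂ} {ε : ℝ}
    (hε : 0 ≤ ε) (h : ∀ l ∈ B.charpoly.roots, ‖φ l - ψ l‖ ≤ ε) :
    ‖(n : ℂ)⁻¹ * (B.charpoly.roots.map φ).sum - (n : ℂ)⁻¹ * (B.charpoly.roots.map ψ).sum‖ ≤ ε := by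
  have hcard : Multiset.card B.charpoly.roots = n := by
    rw [← (IsAlgClosed.splits B.charpoly).natDegree_eq_card_roots,
      Matrix.charpoly_natDegree_eq_dim, Fintype.card_fin]
  have h1 : ‖(B.charpoly.roots.map fun l => φ l - ψ l).sum‖ ≤ n * ε := by
    refine (norm_multiset_sum_le _).trans ?_
    rw [Multiset.map_map]
    refine (Multiset.sum_le_card_nsmul _ ε ?_).trans ?_
    · intro x hx
      obtain ⟨l, hl, rfl⟩ := Multiset.mem_map.1 hx
      exact h l hl
    · rw [Multiset.card_map, hcard, nsmul_eq_mul]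
  rw [← mul_sub, ← Multiset.sum_map_sub, norm_mul, norm_inv, Complex.norm_natCast]
  rcases Nat.eq_zero_or_pos n with rfl | hn
  · simpa using hε
  · have hn' : (0 : ℝ) < n := by exact_mod_cast hn
    rw [inv_mul_le_iff₀ hn']
    exact h1

variable [MeasurableSpace EllOne] [BorelSpace EllOne] {A : MatrixSeq} {X : Set EllOne}
  {μ : Measure X} {M : ℝ}

theorem integrable_fourierF_pow [IsFiniteMeasure μ] (hμ : ∀ᵐ z : X ∂μ, ‖(z : EllOne)‖ ≤ M)
    (m : ℕ) : Integrable (fun p : X × ℝ => fourierF p.1 p.2 ^ m) (prodCircle μ) := by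
  refine Integrable.of_bound (C := M ^ m)
    (measurable_fourierF.pow_const m).aestronglyMeasurable ?_
  filter_upwards [ae_prodCircle hμ] with p hp
  rw [norm_pow]
  exact pow_le_pow_left₀ (norm_nonneg _) ((norm_fourierF_le _ _).trans hp) m

theorem integrable_eval_fourierF [IsFiniteMeasure μ] (hμ : ∀ᵐ z : X ∂μ, ‖(z : EllOne)‖ ≤ M)
    (q : Polynomial ℂ) :
    Integrable (fun p : X × ℝ => q.eval (fourierF p.1 p.2)) (prodCircle μ) := by
  simp only [Polynomial.eval_eq_sum_range]
  exact integrable_finsetSum _ fun i _ => (integrable_fourierF_pow hμ i).const_mul _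

theorem tendsto_sum_roots_eval [IsProbabilityMeasure μ] (hA : VanishingMeanVariation A)
    (hμ : IsMuDistributed A X μ) (hM : ∀ n, diagMaxSum (A n) ≤ M) (q : Polynomial ℂ) :
    Tendsto (fun n : ℕ => (n : ℂ)⁻¹ * ((A n).charpoly.roots.map fun l => q.eval l).sum) atTop
      (𝓝 ((2 * (Real.pi : ℂ))⁻¹ * ∫ p, q.eval (fourierF p.1 p.2) ∂(prodCircle μ))) := by
  have hi := integrable_fourierF_pow (hμ.ae_norm_le hM)
  simp only [Polynomial.eval_eq_sum_range]
  rw [integral_finsetSum _ fun i _ => (hi i).const_mul _]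
  simp only [integral_const_mul, Multiset.sum_map_sum, Multiset.sum_map_mul_left, Finset.mul_sum,
    ← Matrix.trace_pow_eq_sum_roots]
  refine tendsto_finsetSum _ fun i _ => ?_
  have h := (tendsto_trace_pow hA hμ hM i).const_mul (q.coeff i)
  rw [mul_left_comm] at h
  refine h.congr fun n => ?_
  rw [mul_left_comm]

/-- The limit formula for functions that are uniformly approximated by polynomials on a set
containing all eigenvalues and almost all values of the symbol. -/
theorem integrable_and_tendsto_of_polynomial_approx [IsProbabilityMeasure μ]
    (hA : VanishingMeanVariation A) (hμ : IsMuDistributed A X μ)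
    (hM : ∀ n, diagMaxSum (A n) ≤ M) {D : Set ℂ}
    (hroots : ∀ n, ∀ l ∈ (A n).charpoly.roots, l ∈ D)
    (hF : ∀ᵐ z : X ∂μ, ∀ t : ℝ, fourierF z t ∈ D) {φ : ℂ → ℂ}
    (hφ : ∀ ε > 0, ∃ q : Polynomial ℂ, ∀ z ∈ D, ‖φ z - q.eval z‖ ≤ ε) :
    Integrable (fun p : X × ℝ => φ (fourierF p.1 p.2))
        (μ.prod (volume.restrict (Set.Ioc (-Real.pi) Real.pi))) ∧
      Tendsto (fun n : ℕ => (n : ℂ)⁻¹ * ((A n).charpoly.roots.map φ).sum) atTop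
        (𝓝 ((2 * (Real.pi : ℂ))⁻¹ *
          ∫ t in (-Real.pi)..Real.pi, ∫ z : X, φ (fourierF z t) ∂μ)) := by
  have hae := hμ.ae_norm_le hM
  choose q hq using fun K : ℕ => hφ (1 / ((K : ℝ) + 1)) Nat.one_div_pos_of_nat
  have hqF : ∀ K, ∀ᵐ p : X × ℝ ∂(prodCircle μ),
      ‖φ (fourierF p.1 p.2) - (q K).eval (fourierF p.1 p.2)‖ ≤ 1 / ((K : ℝ) + 1) := by
    intro K
    filter_upwards [ae_prodCircle hF] with p hp
    exact hq K _ (hp p.2)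
  have hiq := fun K => integrable_eval_fourierF hae (q K)
  have hT := tendsto_one_div_add_atTop_nhds_zero_nat (𝕜 := ℝ)
  -- Nothing is known about `φ` off `D`, so measurability is obtained from the almost everywhere
  -- convergence of the approximating polynomials in `F`.
  have hmeas : AEStronglyMeasurable (fun p : X × ℝ => φ (fourierF p.1 p.2)) (prodCircle μ) := by
    refine aestronglyMeasurable_of_tendsto_ae atTop (fun K => (hiq K).aestronglyMeasurable) ?_
    filter_upwards [ae_all_iff.2 hqF] with p hp
    rw [tendsto_iff_norm_sub_tendsto_zero]
    refine squeeze_zero (fun _ => norm_nonneg _) (fun K => ?_) hT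
    rw [norm_sub_rev]
    exact hp K
  have hint : Integrable (fun p : X × ℝ => φ (fourierF p.1 p.2)) (prodCircle μ) := by
    have h : Integrable (fun p : X × ℝ => φ (fourierF p.1 p.2) - (q 0).eval (fourierF p.1 p.2))
        (prodCircle μ) := Integrable.of_bound (hmeas.sub (hiq 0).aestronglyMeasurable) _ (hqF 0)
    exact (h.add (hiq 0)).congr (Eventually.of_forall fun p => sub_add_cancel _ _)
  refine ⟨hint, ?_⟩
  have hlim : ∫ t in (-Real.pi)..Real.pi, ∫ z : X, φ (fourierF z t) ∂μ =
      ∫ p, φ (fourierF p.1 p.2) ∂(prodCircle μ) := by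
    rw [integral_prod_symm _ hint, intervalIntegral.integral_of_le (by linarith [Real.pi_pos])]
  rw [hlim]
  refine tendsto_of_approx
    (b := fun K n => (n : ℂ)⁻¹ * ((A n).charpoly.roots.map fun l => (q K).eval l).sum)
    (d := fun K _ => 1 / ((K : ℝ) + 1)) ?_ (fun K => tendsto_sum_roots_eval hA hμ hM (q K))
    (fun K => tendsto_const_nhds) (Tendsto.const_mul _ ?_) hT
  · intro K n
    exact norm_inv_mul_sum_roots_le (A n) (by positivity) fun l hl => hq K l (hroots n l hl)
  · rw [tendsto_iff_norm_sub_tendsto_zero]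
    have h0 := hT.mul_const ((prodCircle μ).real Set.univ)
    rw [zero_mul] at h0
    refine squeeze_zero (fun _ => norm_nonneg _) (fun K => ?_) h0
    rw [← integral_sub (hiq K) hint]
    refine norm_integral_le_of_norm_le_const ?_
    filter_upwards [hqF K] with p hp
    rwa [norm_sub_rev]

end Limit

/-! ### Reality of the symbol in the Hermitian case. -/

section Hermitian

theorem diagEntry_neg_of_isHermitian {n : ℕ} {B : Matrix (Fin n) (Fin n) ℂ}
    (hB : B.IsHermitian) (k : ℤ) (j : ℕ) :
    diagEntry B (-k) j = starRingEnd ℂ (diagEntry B k j) := by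
  unfold diagEntry
  simp only [neg_neg]
  split_ifs with h1 h2 h2
  · exact (hB.apply _ _).symm
  · exact absurd h1.symm h2
  · exact absurd h2.symm h1
  · simp

/-- The lower cut-off of `diagSeq` breaks the symmetry only for `j < |k|`; the upper one removes
only positions outside the matrix. -/
theorem diagSeq_neg_of_isHermitian {n : ℕ} {B : Matrix (Fin n) (Fin n) ℂ}
    (hB : B.IsHermitian) {k : ℤ} {j : ℕ} (hj : k.natAbs ≤ j) :
    diagSeq B j (-k) = starRingEnd ℂ (diagSeq B j k) := by
  have h : ∀ k : ℤ, k.natAbs ≤ j → diagSeq B j k = diagEntry B k j := by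
    intro k hk
    rw [diagSeq_apply]
    split_ifs with h
    · rfl
    · unfold diagEntry
      rw [dif_neg (by omega)]
  rw [h k hj, h (-k) (by omega), diagEntry_neg_of_isHermitian hB]

theorem fourierF_im_eq_zero {z : EllOne} (hz : ∀ k : ℤ, z (-k) = starRingEnd ℂ (z k)) (t : ℝ) :
    (fourierF z t).im = 0 := by
  rw [← Complex.conj_eq_iff_im]
  have h1 := (hasSum_fourierF z t).map (starRingEnd ℂ) Complex.continuous_conj
  have h2 := (Equiv.neg ℤ).hasSum_iff.2 (hasSum_fourierF z t)
  refine h1.unique ?_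
  have h : ∀ k : ℤ, z (-k) * Complex.exp (Complex.I * ((-k : ℤ) : ℂ) * (t : ℂ)) =
      starRingEnd ℂ (z k * Complex.exp (Complex.I * (k : ℂ) * (t : ℂ))) := by
    intro k
    rw [hz, map_mul, ← Complex.exp_conj]
    simp
  exact h2.congr_fun fun k => (h k).symm

variable [MeasurableSpace EllOne] [BorelSpace EllOne] {A : MatrixSeq} {X : Set EllOne}
  {μ : Measure X} {M : ℝ}

/-- The defect of symmetry at `k` is tested against `μ`. Along the `a_j(n)` at most `|k|` indices
`j` contribute, each at most `2 * M`, so the averages tend to `0`. -/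
theorem ae_neg_eq_conj_of_isHermitian [IsFiniteMeasure μ] (hμ : IsMuDistributed A X μ)
    (hM : ∀ n, diagMaxSum (A n) ≤ M) (hH : ∀ n, (A n).IsHermitian) :
    ∀ᵐ z : X ∂μ, ∀ k : ℤ, (z : EllOne) (-k) = starRingEnd ℂ ((z : EllOne) k) := by
  rw [ae_all_iff]
  intro k
  have hM0 : 0 ≤ M := (diagMaxSum_nonneg (A 0)).trans (hM 0)
  have hcont : Continuous fun z : EllOne => ‖z (-k) - starRingEnd ℂ (z k)‖ :=
    ((EllOne.continuous_apply (-k)).sub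
      (Complex.continuous_conj.comp (EllOne.continuous_apply k))).norm
  have hb : ∀ z : EllOne, ‖z‖ ≤ M → ‖z (-k) - starRingEnd ℂ (z k)‖ ≤ 2 * M := by
    intro z hz
    refine (norm_sub_le _ _).trans ?_
    rw [RCLike.norm_conj]
    linarith [EllOne.norm_apply_le z k, EllOne.norm_apply_le z (-k)]
  have h := hμ.tendsto_real hM hcont (C := 2 * M) fun z hz => by
    rw [abs_of_nonneg (norm_nonneg _)]
    exact hb z hz
  have h0 : Tendsto (fun n : ℕ => (n : ℝ)⁻¹ * ∑ j ∈ Finset.range n,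
      ‖diagSeq (A n) j (-k) - starRingEnd ℂ (diagSeq (A n) j k)‖) atTop (𝓝 0) := by
    have hlim := (tendsto_inv_atTop_nhds_zero_nat (𝕜 := ℝ)).mul_const (k.natAbs * (2 * M))
    rw [zero_mul] at hlim
    refine squeeze_zero (fun n => by positivity) (fun n => ?_) hlim
    gcongr
    calc ∑ j ∈ Finset.range n, ‖diagSeq (A n) j (-k) - starRingEnd ℂ (diagSeq (A n) j k)‖
        ≤ ∑ j ∈ Finset.range n, if j < k.natAbs then 2 * M else 0 := by
          refine Finset.sum_le_sum fun j hj => ?_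
          split_ifs with hjk
          · exact hb _ ((norm_diagSeq_le (A n) (Finset.mem_range.1 hj).le).trans (hM n))
          · rw [diagSeq_neg_of_isHermitian (hH n) (not_lt.1 hjk), sub_self, norm_zero]
      _ ≤ k.natAbs * (2 * M) := by
          rw [← Finset.sum_filter, Finset.sum_const, nsmul_eq_mul]
          gcongr
          refine (Finset.card_le_card (t := Finset.range k.natAbs) fun j hj => ?_).trans
            (Finset.card_range _).le
          exact Finset.mem_range.2 (Finset.mem_filter.1 hj).2
  have hint := tendsto_nhds_unique h h0
  have hi : Integrable (fun z : X => ‖(z : EllOne) (-k) - starRingEnd ℂ ((z : EllOne) k)‖) μ := by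
    refine Integrable.of_bound (C := 2 * M)
      (hcont.comp continuous_subtype_val).aestronglyMeasurable ?_
    filter_upwards [hμ.ae_norm_le hM] with z hz
    rw [norm_norm]
    exact hb z hz
  rw [integral_eq_zero_iff_of_nonneg (fun z => norm_nonneg _) hi] at hint
  filter_upwards [hint] with z hz
  exact sub_eq_zero.1 (norm_eq_zero.1 hz)

end Hermitian

/-! ### The main theorem. -/

/-- Eigenvalues are counted with algebraic multiplicity, as the roots of the characteristic
polynomial; for Hermitian matrices they are the real numbers `Matrix.IsHermitian.eigenvalues`. -/
theorem mainTheorem1 [MeasurableSpace EllOne] [BorelSpace EllOne]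
    (A : MatrixSeq) (X : Set EllOne) (hX : IsCompact X)
    (μ : Measure X) [IsProbabilityMeasure μ]
    (hA : VanishingMeanVariation A) (hμ : IsMuDistributed A X μ)
    (M : ℝ) (hM : IsLUB (Set.range fun n : ℕ => diagMaxSum (A n)) M) :
    (∀ n : ℕ, ∀ l ∈ (A n).charpoly.roots, ‖l‖ ≤ M) ∧
    (∀ᵐ z : X ∂μ, ∀ t : ℝ, ‖fourierF z t‖ ≤ M) ∧
    (∀ φ : ℂ → ℂ, ContinuousOn φ (Metric.closedBall 0 M) →
      AnalyticOnNhd ℂ φ (Metric.ball 0 M) →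
        Integrable (fun p : X × ℝ => φ (fourierF p.1 p.2))
          (μ.prod (volume.restrict (Set.Ioc (-Real.pi) Real.pi))) ∧
        Tendsto (fun n : ℕ => (n : ℂ)⁻¹ * ((A n).charpoly.roots.map φ).sum) atTop
          (𝓝 ((2 * (Real.pi : ℂ))⁻¹ *
            ∫ t in (-Real.pi)..Real.pi, ∫ z : X, φ (fourierF z t) ∂μ))) ∧
    (∀ hH : ∀ n : ℕ, (A n).IsHermitian,
      (∀ᵐ z : X ∂μ, ∀ t : ℝ, (fourierF z t).im = 0) ∧
      ∀ φ : ℝ → ℂ, ContinuousOn φ (Set.Icc (-M) M) →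
        Integrable (fun p : X × ℝ => φ (fourierF p.1 p.2).re)
          (μ.prod (volume.restrict (Set.Ioc (-Real.pi) Real.pi))) ∧
        Tendsto (fun n : ℕ => (n : ℂ)⁻¹ * ∑ i : Fin n, φ ((hH n).eigenvalues i)) atTop
          (𝓝 ((2 * (Real.pi : ℂ))⁻¹ *
            ∫ t in (-Real.pi)..Real.pi, ∫ z : X, φ (fourierF z t).re ∂μ))) := by
  have hM' : ∀ n, diagMaxSum (A n) ≤ M := fun n => hM.1 ⟨n, rfl⟩
  have hM0 : 0 ≤ M := (diagMaxSum_nonneg (A 0)).trans (hM' 0)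
  have hroots : ∀ n : ℕ, ∀ l ∈ (A n).charpoly.roots, ‖l‖ ≤ M := fun n l hl =>
    Matrix.norm_le_of_mem_roots_charpoly
      (fun i => (sum_row_le_diagMaxSum (A n) i).trans (hM' n)) hl
  have hF : ∀ᵐ z : X ∂μ, ∀ t : ℝ, ‖fourierF z t‖ ≤ M := by
    filter_upwards [hμ.ae_norm_le hM'] with z hz t
    exact (norm_fourierF_le _ _).trans hz
  refine ⟨hroots, hF, fun φ hc ha => ?_, fun hH => ?_⟩
  · refine integrable_and_tendsto_of_polynomial_approx hA hμ hM'
      (D := Metric.closedBall 0 M) (fun n l hl => by simpa using hroots n l hl)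
      (by simpa using hF) fun ε hε => exists_polynomial_near_of_analytic_ball hM0 hc ha hε
  · have him : ∀ᵐ z : X ∂μ, ∀ t : ℝ, (fourierF z t).im = 0 := by
      filter_upwards [ae_neg_eq_conj_of_isHermitian hμ hM' hH] with z hz
      exact fourierF_im_eq_zero hz
    refine ⟨him, fun φ hc => ?_⟩
    have hsum : ∀ n, ∑ i : Fin n, φ ((hH n).eigenvalues i) =
        ((A n).charpoly.roots.map fun l : ℂ => φ l.re).sum := by
      intro n
      rw [(hH n).roots_charpoly_eq_eigenvalues, Multiset.map_map]
      rfl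
    simp_rw [hsum]
    -- On the real diameter `l ↦ φ l.re` is just `φ`, so the Weierstrass theorem replaces
    -- analyticity.
    refine integrable_and_tendsto_of_polynomial_approx hA hμ hM'
      (D := {z | ‖z‖ ≤ M ∧ z.im = 0}) (φ := fun l => φ l.re) (fun n l hl => ?_) ?_ ?_
    · refine ⟨hroots n l hl, ?_⟩
      rw [(hH n).roots_charpoly_eq_eigenvalues] at hl
      obtain ⟨i, _, rfl⟩ := Multiset.mem_map.1 hl
      simp
    · filter_upwards [hF, him] with z h1 h2 t
      exact ⟨h1 t, h2 t⟩
    · intro ε hε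
      obtain ⟨q, hq⟩ := exists_polynomial_near_of_continuousOn_complex hc hε
      refine ⟨q, fun z hz => ?_⟩
      have h := hq z.re (abs_le.1 ((Complex.abs_re_le_norm z).trans hz.1))
      rwa [show ((z.re : ℝ) : ℂ) = z from Complex.ext rfl (by simp [hz.2])] at h
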